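/- Floquet multipliers of near-impulse extended time-delayed feedback. Let $f:\mathbb{R}^n\times\mathbb{R}\to\mathbb{R}^n$ be smooth, and let $x_*$ be a non-constant periodic orbit of period $T>0$ of $\dot x=f(x,0)$. Put $A(t)=\partial_xf(x_*(t),0)$ and $b(t)=\partial_uf(x_*(t),0)$, and let $P_0=Y(T)$ be the monodromy matrix, where $\dot Y=A(t)Y$, $Y(0)=I$. Let $K_0\in\mathbb{R}^n$. For $\delta\in(0,T)$ let $\Delta_\delta(t)=1/\delta$ if $t \bmod [0,T)\in[0,\delta]$, and $\Delta_\delta(t)=0$ otherwise. For $\epsilon\in(0,1)$ consider the feedback system $$\dot x(t)=f\bigl(x(t),\Delta_\delta(t)K_0^T[\tilde x(t)-x(t)]\bigr),\qquad \tilde x(t)=(1-\epsilon)\tilde x(t-T)+\epsilon x(t-T),$$ whose linearisation along the periodic orbit $x=\tilde x=x_*$ is $$\dot x(t)=A(t)x(t)+b(t)\Delta_\delta(t)K_0^T[\tilde x(t)-x(t)],\qquad \tilde x(t)=(1-\epsilon)\tilde x(t-T)+\epsilon x(t-T).$$ The Floquet multipliers of $x=\tilde x=x_*$ are the eigenvalues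 of the time-$T$ map of this linear system on the (complexified) space of histories $$\{(x,\tilde x)\in C([-T,0];\mathbb{C}^n\times\mathbb{C}^n):\ \tilde x(0)=(1-\epsilon)\tilde x(-T)+\epsilon x(-T)\};$$ a multiplier is simple if its algebraic multiplicity (the dimension of its generalised eigenspace) is one. Assume that for some $r<1$ all (complex) eigenvalues of $P_0\exp(-b(0)K_0^T)$ lie in the open ball $B_r(0)$. Then there exist $\epsilon_{\max}\in(0,1)$ and $\delta_{\max}\in(0,T)$ such that for all $\epsilon\in(0,\epsilon_{\max})$ and all $\delta\in(0,\delta_{\max})$ the periodic orbit $x=\tilde x=x_*$ has the simple Floquet multiplier $\lambda=1$, and all its other Floquet multipliers satisfy $|\lambda|<1$. -/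

import Mathlib

open Set MeasureTheory
open scoped ContDiff Matrix

namespace DelayedFeedback

/-! ### Linear integral equations: existence and uniqueness of solutions -/

section Volterra

variable {E : Type*} [NormedAddCommGroup E] [NormedSpace ℝ E]

/-- `x : [a, b] → E` solves `x' = G(t, x)`, `x(a) = x₀` in the sense of Carathéodory, that is,
`x(t) = x₀ + ∫_a^t G(s, x(s)) ds` for all `t ∈ [a, b]`. -/
def IsSolution {a b : ℝ} (hab : a ≤ b) (G : ℝ → E → E) (x₀ : E) (x : C(Icc a b, E)) : Prop :=
  ∀ t : Icc a b, x t = x₀ + ∫ s in a..(t : ℝ), G s (IccExtend hab x s)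

/-- Existence and uniqueness of solutions for right-hand sides that are uniformly Lipschitz
in the state. -/
theorem existsUnique_isSolution [CompleteSpace E] {a b : ℝ} (hab : a ≤ b) (G : ℝ → E → E)
    (C : ℝ) (hLip : ∀ t ∈ Icc a b, ∀ x y, ‖G t x - G t y‖ ≤ C * ‖x - y‖)
    (hint : ∀ x : ℝ → E, Continuous x → IntervalIntegrable (fun t => G t (x t)) volume a b)
    (x₀ : E) : ∃! x : C(Icc a b, E), IsSolution hab G x₀ x := by
  have hC : 0 ≤ |C| := abs_nonneg C
  have hLip' : ∀ t ∈ Icc a b, ∀ x y, ‖G t x - G t y‖ ≤ |C| * ‖x - y‖ := fun t ht x y =>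
    (hLip t ht x y).trans (mul_le_mul_of_nonneg_right (le_abs_self C) (norm_nonneg _))
  have hcont : ∀ x : C(Icc a b, E), Continuous (IccExtend hab x) := fun x =>
    x.continuous.Icc_extend'
  have hii : ∀ (x : C(Icc a b, E)) (t : ℝ), t ∈ Icc a b →
      IntervalIntegrable (fun s => G s (IccExtend hab x s)) volume a t := fun x t ht =>
    (hint _ (hcont x)).mono_set (by
      rw [uIcc_of_le hab, uIcc_of_le ht.1]; exact Icc_subset_Icc le_rfl ht.2)
  let F : C(Icc a b, E) → C(Icc a b, E) := fun x =>
    ⟨fun t => x₀ + ∫ s in a..(t : ℝ), G s (IccExtend hab x s), by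
      have h := intervalIntegral.continuousOn_primitive_interval'
        (hint _ (hcont x)) (left_mem_uIcc)
      rw [uIcc_of_le hab] at h
      exact continuous_const.add (continuousOn_iff_continuous_domRestrict.1 h)⟩
  have hF : ∀ x t, F x t = x₀ + ∫ s in a..(t : ℝ), G s (IccExtend hab x s) := fun _ _ => rfl
  have key : ∀ (k : ℕ) (x y : C(Icc a b, E)) (t : Icc a b),
      ‖(F^[k] x) t - (F^[k] y) t‖ ≤ (|C| * (t - a)) ^ k / (k.factorial : ℝ) * ‖x - y‖ := by
    intro k x y
    induction k with
    | zero =>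
      intro t
      simpa using ContinuousMap.norm_coe_le_norm (x - y) t
    | succ k ih =>
      intro t
      rw [Function.iterate_succ_apply', Function.iterate_succ_apply', hF, hF,
        add_sub_add_left_eq_sub, ← intervalIntegral.integral_sub (hii _ _ t.2) (hii _ _ t.2)]
      have hder : ∀ s : ℝ, HasDerivAt
          (fun s => (|C| * (s - a)) ^ (k + 1) / ((k + 1).factorial : ℝ) * ‖x - y‖)
          (|C| * ((|C| * (s - a)) ^ k / (k.factorial : ℝ) * ‖x - y‖)) s := by
        intro s
        have h1 : HasDerivAt (fun s : ℝ => |C| * (s - a)) |C| s := by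
          simpa using ((hasDerivAt_id s).sub_const a).const_mul |C|
        have h2 := ((h1.pow (k + 1)).div_const ((k + 1).factorial : ℝ)).mul_const ‖x - y‖
        refine h2.congr_deriv ?_
        have hk : (k.factorial : ℝ) ≠ 0 := by exact_mod_cast k.factorial_ne_zero
        have hk1 : ((k : ℝ) + 1) ≠ 0 := by positivity
        rw [Nat.factorial_succ]
        push_cast
        field_simp
        try simp
      have hcd : Continuous fun s : ℝ =>
          |C| * ((|C| * (s - a)) ^ k / (k.factorial : ℝ) * ‖x - y‖) := by fun_prop
      have hI : ∫ s in a..(t : ℝ), |C| * ((|C| * (s - a)) ^ k / (k.factorial : ℝ) * ‖x - y‖)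
          = (|C| * (t - a)) ^ (k + 1) / ((k + 1).factorial : ℝ) * ‖x - y‖ := by
        rw [intervalIntegral.integral_eq_sub_of_hasDerivAt (fun s _ => hder s)
          (hcd.intervalIntegrable _ _)]
        simp
      rw [← hI]
      refine intervalIntegral.norm_integral_le_of_norm_le t.2.1 ?_ (hcd.intervalIntegrable _ _)
      filter_upwards with s hs
      have hs' : s ∈ Icc a b := ⟨hs.1.le, hs.2.trans t.2.2⟩
      refine (hLip' s hs' _ _).trans (mul_le_mul_of_nonneg_left ?_ hC)
      rw [IccExtend_of_mem hab _ hs', IccExtend_of_mem hab _ hs']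
      exact ih ⟨s, hs'⟩
  obtain ⟨k, hk⟩ := ((FloorSemiring.tendsto_pow_div_factorial_atTop (|C| * (b - a))).eventually
    (gt_mem_nhds (show (0 : ℝ) < 1 / 2 by norm_num))).exists
  have hcontr : ContractingWith (1 / 2) F^[k] := by
    refine ⟨by rw [← NNReal.coe_lt_coe]; norm_num, LipschitzWith.of_dist_le_mul fun x y => ?_⟩
    rw [dist_eq_norm, dist_eq_norm]
    refine (ContinuousMap.norm_le _ (by positivity)).2 fun t => ?_
    refine (key k x y t).trans (mul_le_mul_of_nonneg_right ?_ (norm_nonneg _))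
    refine le_trans ?_ (hk.le.trans (by norm_num))
    have h1 : 0 ≤ (t : ℝ) - a := sub_nonneg.2 t.2.1
    have h2 : (t : ℝ) - a ≤ b - a := sub_le_sub_right t.2.2 a
    gcongr
  have : Nonempty C(Icc a b, E) := ⟨0⟩
  have hiff : ∀ x, IsSolution hab G x₀ x ↔ Function.IsFixedPt F x := fun x =>
    ⟨fun h => ContinuousMap.ext fun t => (h t).symm, fun h t => (DFunLike.congr_fun h t).symm⟩
  refine ⟨_, (hiff _).2 hcontr.isFixedPt_fixedPoint_iterate, fun y hy => ?_⟩
  exact hcontr.fixedPoint_unique (((hiff y).1 hy).iterate k)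

end Volterra

/-! ### The uncontrolled periodic orbit -/

/-- A control system `x' = f(x, u)` with smooth `f : ℝⁿ × ℝ → ℝⁿ`, together with a (non-constant)
periodic orbit `xs` of period `T > 0` of the uncontrolled system `x' = f(x, 0)`. -/
structure ControlledOrbit (n : ℕ) where
  f : (Fin n → ℝ) × ℝ → (Fin n → ℝ)
  smooth : ContDiff ℝ ∞ f
  T : ℝ
  T_pos : 0 < T
  xs : ℝ → (Fin n → ℝ)
  solves : ∀ t, HasDerivAt xs (f (xs t, 0)) t
  periodic : Function.Periodic xs T
  nonconstant : ∃ t, xs t ≠ xs 0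

namespace ControlledOrbit

variable {n : ℕ} (O : ControlledOrbit n)

/-- `A(t) = ∂ₓ f(xs(t), 0)`, as a Jacobian matrix. -/
noncomputable def A (t : ℝ) : Matrix (Fin n) (Fin n) ℝ :=
  Matrix.of fun i j => fderiv ℝ O.f (O.xs t, 0) (Pi.single j 1, 0) i

/-- `b(t) = ∂ᵤ f(xs(t), 0)`. -/
noncomputable def b (t : ℝ) : Fin n → ℝ :=
  fderiv ℝ O.f (O.xs t, 0) (0, 1)

theorem continuous_fderiv_orbit : Continuous fun t => fderiv ℝ O.f (O.xs t, 0) := by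
  have h1 : Continuous (fderiv ℝ O.f) := O.smooth.continuous_fderiv (by simp)
  have h2 : Continuous O.xs := continuous_iff_continuousAt.2 fun t => (O.solves t).continuousAt
  exact h1.comp (h2.prodMk continuous_const)

theorem continuous_A (i j : Fin n) : Continuous fun t => O.A t i j :=
  (continuous_apply i).comp (O.continuous_fderiv_orbit.clm_apply continuous_const)

theorem continuous_b : Continuous O.b :=
  O.continuous_fderiv_orbit.clm_apply continuous_const

theorem exists_bound (c : ℝ → ℝ) (hc : Continuous c) (a b : ℝ) :
    ∃ C, ∀ t ∈ Icc a b, c t ≤ C := by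
  obtain ⟨C, hC⟩ := (isCompact_Icc (a := a) (b := b)).bddAbove_image hc.continuousOn
  exact ⟨C, fun t ht => hC (mem_image_of_mem c ht)⟩

theorem norm_mulVec_le {𝕜 : Type*} [RCLike 𝕜] (M : Matrix (Fin n) (Fin n) 𝕜) (v : Fin n → 𝕜) :
    ‖M *ᵥ v‖ ≤ (∑ i, ∑ j, ‖M i j‖) * ‖v‖ := by
  refine (pi_norm_le_iff_of_nonneg (by positivity)).2 fun i => ?_
  calc ‖∑ j, M i j * v j‖ ≤ ∑ j, ‖M i j‖ * ‖v‖ := by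
        refine (norm_sum_le _ _).trans (Finset.sum_le_sum fun j _ => ?_)
        rw [norm_mul]
        exact mul_le_mul_of_nonneg_left (norm_le_pi_norm v j) (norm_nonneg _)
    _ = (∑ j, ‖M i j‖) * ‖v‖ := by rw [Finset.sum_mul]
    _ ≤ _ := mul_le_mul_of_nonneg_right
        (Finset.single_le_sum (f := fun i => ∑ j, ‖M i j‖) (fun i _ => by positivity)
          (Finset.mem_univ i)) (norm_nonneg _)

theorem existsUnique_openLoop (v : Fin n → ℝ) :
    ∃! y : C(Icc 0 O.T, Fin n → ℝ), IsSolution O.T_pos.le (fun t x => O.A t *ᵥ x) v y := by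
  obtain ⟨C, hC⟩ := exists_bound (fun t => ∑ i, ∑ j, ‖O.A t i j‖)
    (continuous_finsetSum _ fun i _ => continuous_finsetSum _ fun j _ =>
      (O.continuous_A i j).norm) 0 O.T
  refine existsUnique_isSolution _ _ C (fun t ht x y => ?_) (fun x hx => ?_) v
  · rw [← Matrix.mulVec_sub]
    exact (norm_mulVec_le _ _).trans (mul_le_mul_of_nonneg_right (hC t ht) (norm_nonneg _))
  · exact (Continuous.matrix_mulVec (continuous_matrix fun i j => O.continuous_A i j)
      hx).intervalIntegrable _ _

/-- The solution on `[0, T]` of `y' = A(t) y`, `y(0) = v`. -/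
noncomputable def openLoopSolution (v : Fin n → ℝ) : C(Icc 0 O.T, Fin n → ℝ) :=
  (O.existsUnique_openLoop v).choose

/-- The monodromy matrix `P₀ = Y(T)` of the uncontrolled system, where `Y' = A(t) Y`, `Y(0) = I`;
its `j`-th column is the value at time `T` of the solution that starts from the `j`-th unit
vector. -/
noncomputable def P₀ : Matrix (Fin n) (Fin n) ℝ :=
  Matrix.of fun i j => O.openLoopSolution (Pi.single j 1) ⟨O.T, O.T_pos.le, le_rfl⟩ i

/-! ### Near-impulse extended time-delayed feedback and its linearisation -/

/-- The near-impulse `Δ_δ`: it equals `1/δ` if `t mod [0,T)` lies in `[0,δ]`, and `0` otherwise. -/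
noncomputable def impulse (δ t : ℝ) : ℝ :=
  open Classical in if toIcoMod O.T_pos 0 t ∈ Icc 0 δ then 1 / δ else 0

/-- The right-hand side `f(x, Δ_δ(t) K₀ᵀ(x̃ - x))` of the controlled system, as a function of
`(x, x̃)`. -/
noncomputable def rhs (K₀ : Fin n → ℝ) (δ t : ℝ) (p : (Fin n → ℝ) × (Fin n → ℝ)) : Fin n → ℝ :=
  O.f (p.1, O.impulse δ t * ∑ j, K₀ j * (p.2 j - p.1 j))

/-- The right-hand side of the (complexified) linearisation along `x = x̃ = xs` of
`x' = f(x, Δ_δ(t) K₀ᵀ(x̃ - x))`, namely `A(t) x + b(t) Δ_δ(t) K₀ᵀ (x̃ - x)`. -/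
noncomputable def linRhs (K₀ : Fin n → ℝ) (δ t : ℝ) (x xt : Fin n → ℂ) : Fin n → ℂ :=
  (O.A t).map Complex.ofReal *ᵥ x +
    ((O.impulse δ t : ℂ) * ∑ j, (K₀ j : ℂ) * (xt j - x j)) • fun i => (O.b t i : ℂ)

/-- On real vectors, `linRhs` is the derivative of the controlled right-hand side at
`x = x̃ = xs(t)`. -/
theorem linRhs_ofReal (K₀ : Fin n → ℝ) (δ t : ℝ) (x xt : Fin n → ℝ) :
    O.linRhs K₀ δ t (fun j => (x j : ℂ)) (fun j => (xt j : ℂ)) =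
      fun i => ((fderiv ℝ (O.rhs K₀ δ t) (O.xs t, O.xs t) (x, xt) i : ℝ) : ℂ) := by
  let ℓ : ((Fin n → ℝ) × (Fin n → ℝ)) →L[ℝ] ℝ := O.impulse δ t • ∑ j, K₀ j •
    ((ContinuousLinearMap.proj (R := ℝ) (φ := fun _ : Fin n => ℝ) j).comp
      (ContinuousLinearMap.snd ℝ (Fin n → ℝ) (Fin n → ℝ) -
        ContinuousLinearMap.fst ℝ (Fin n → ℝ) (Fin n → ℝ)))
  have hℓ : ∀ p, ℓ p = O.impulse δ t * ∑ j, K₀ j * (p.2 j - p.1 j) := fun p => by simp [ℓ]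
  let L := (ContinuousLinearMap.fst ℝ (Fin n → ℝ) (Fin n → ℝ)).prod ℓ
  have hL : O.rhs K₀ δ t = O.f ∘ L := funext fun p => by simp [rhs, L, hℓ]
  have hp : L (O.xs t, O.xs t) = (O.xs t, 0) := by simp [L, hℓ]
  have hd : HasFDerivAt O.f (fderiv ℝ O.f (O.xs t, 0)) (L (O.xs t, O.xs t)) := by
    rw [hp]
    exact (O.smooth.differentiable (by simp) _).hasFDerivAt
  rw [hL, (hd.comp _ L.hasFDerivAt).fderiv]
  have hsplit : L (x, xt) = (∑ j, x j • ((Pi.single j 1 : Fin n → ℝ), (0 : ℝ))) +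
      ℓ (x, xt) • ((0 : Fin n → ℝ), (1 : ℝ)) := by
    refine Prod.ext ?_ ?_
    · ext i
      simp [L, Prod.fst_sum, Finset.sum_apply, Pi.single_apply]
    · simp [L, Prod.snd_sum]
  ext i
  rw [ContinuousLinearMap.comp_apply, hsplit, map_add, map_sum, map_smul, hℓ]
  simp only [map_smul, linRhs, Matrix.mulVec, dotProduct, Pi.add_apply, Finset.sum_apply,
    Pi.smul_apply, smul_eq_mul, Matrix.map_apply, A, b, Matrix.of_apply]
  push_cast
  congr 1
  exact Finset.sum_congr rfl fun j _ => mul_comm _ _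

/-- Histories: continuous functions on `[-T, 0]` with values in `ℂⁿ`. -/
abbrev History : Type := C(Icc (-O.T) 0, Fin n → ℂ)

theorem neg_T_le : -O.T ≤ 0 := neg_nonpos.2 O.T_pos.le

/-- The point `-T` of `[-T, 0]`. -/
def start : Icc (-O.T) 0 := ⟨-O.T, le_rfl, O.neg_T_le⟩

/-- The point `0` of `[-T, 0]`. -/
def final : Icc (-O.T) 0 := ⟨0, O.neg_T_le, le_rfl⟩

/-- The (complexified) phase space: pairs `(x, x̃)` of continuous functions on `[-T, 0]` with
`x̃(0) = (1 - ε) x̃(-T) + ε x(-T)`. -/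
def phaseSpace (ε : ℝ) : Submodule ℂ (O.History × O.History) where
  carrier := {φ | φ.2 O.final = (1 - ε : ℂ) • φ.2 O.start + (ε : ℂ) • φ.1 O.start}
  zero_mem' := by simp
  add_mem' := by
    intro φ ψ hφ hψ
    simp only [mem_ofPred_eq, Prod.fst_add, Prod.snd_add, ContinuousMap.add_apply] at *
    rw [hφ, hψ]
    module
  smul_mem' := by
    intro c φ hφ
    simp only [mem_ofPred_eq, Prod.smul_fst, Prod.smul_snd, ContinuousMap.smul_apply] at *
    rw [hφ]
    module

/-- `ψ` is the image of the history `φ = (x, x̃)|_[-T,0]` under the time-`T` map of the linear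
system `x' = A(t) x + b(t) Δ_δ(t) K₀ᵀ (x̃ - x)`, `x̃(t) = (1 - ε) x̃(t - T) + ε x(t - T)`: that is,
`ψ(s) = (x(s + T), x̃(s + T))` for `s ∈ [-T, 0]`, where the solution is continued from `φ` to
`[0, T]`. -/
structure IsTimeTImage (K₀ : Fin n → ℝ) (ε δ : ℝ) (φ ψ : O.History × O.History) : Prop where
  snd_eq : ∀ s, ψ.2 s = (1 - ε : ℂ) • φ.2 s + (ε : ℂ) • φ.1 s
  fst_eq : IsSolution O.neg_T_le
    (fun s x => O.linRhs K₀ δ (s + O.T) x (IccExtend O.neg_T_le ψ.2 s)) (φ.1 O.final) ψ.1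

theorem impulse_bound (δ t : ℝ) : |O.impulse δ t| ≤ |1 / δ| := by
  unfold impulse
  split_ifs
  · exact le_rfl
  · simp

theorem measurable_impulse (δ : ℝ) : Measurable (O.impulse δ) := by
  classical
  have h : Measurable fun t : ℝ => toIcoMod O.T_pos 0 t := by
    have : (fun t : ℝ => toIcoMod O.T_pos 0 t) = fun t => Int.fract (t / O.T) * O.T :=
      funext fun t => toIcoMod_eq_fract_mul O.T_pos t
    rw [this]
    exact (measurable_fract.comp (measurable_id.div_const _)).mul_const _
  unfold impulse
  exact Measurable.ite (h measurableSet_Icc) measurable_const measurable_const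

theorem linRhs_sub (K₀ : Fin n → ℝ) (δ t : ℝ) (x y xt yt : Fin n → ℂ) :
    O.linRhs K₀ δ t x xt - O.linRhs K₀ δ t y yt = O.linRhs K₀ δ t (x - y) (xt - yt) := by
  simp only [linRhs, Matrix.mulVec_sub, Pi.sub_apply]
  have : ∑ j, (K₀ j : ℂ) * (xt j - yt j - (x j - y j)) =
      ∑ j, (K₀ j : ℂ) * (xt j - x j) - ∑ j, (K₀ j : ℂ) * (yt j - y j) := by
    rw [← Finset.sum_sub_distrib]
    exact Finset.sum_congr rfl fun j _ => by ring
  rw [this]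
  module

theorem linRhs_add (K₀ : Fin n → ℝ) (δ t : ℝ) (x y xt yt : Fin n → ℂ) :
    O.linRhs K₀ δ t (x + y) (xt + yt) = O.linRhs K₀ δ t x xt + O.linRhs K₀ δ t y yt := by
  have h := O.linRhs_sub K₀ δ t (x + y) y (xt + yt) yt
  rw [add_sub_cancel_right, add_sub_cancel_right] at h
  rw [← h, sub_add_cancel]

theorem linRhs_smul (K₀ : Fin n → ℝ) (δ t : ℝ) (c : ℂ) (x xt : Fin n → ℂ) :
    O.linRhs K₀ δ t (c • x) (c • xt) = c • O.linRhs K₀ δ t x xt := by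
  simp only [linRhs, Matrix.mulVec_smul, Pi.smul_apply, smul_eq_mul]
  have : ∑ j, (K₀ j : ℂ) * (c * xt j - c * x j) = c * ∑ j, (K₀ j : ℂ) * (xt j - x j) := by
    rw [Finset.mul_sum]
    exact Finset.sum_congr rfl fun j _ => by ring
  rw [this]
  module

theorem norm_linRhs_le (K₀ : Fin n → ℝ) (δ t : ℝ) (x : Fin n → ℂ) :
    ‖O.linRhs K₀ δ t x 0‖ ≤
      ((∑ i, ∑ j, ‖O.A t i j‖) + |1 / δ| * (∑ j, ‖K₀ j‖) * ‖O.b t‖) * ‖x‖ := by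
  have h1 := norm_mulVec_le ((O.A t).map Complex.ofReal) x
  have h2 : ‖∑ j, (K₀ j : ℂ) * ((0 : Fin n → ℂ) j - x j)‖ ≤ (∑ j, ‖K₀ j‖) * ‖x‖ := by
    rw [Finset.sum_mul]
    refine (norm_sum_le _ _).trans (Finset.sum_le_sum fun j _ => ?_)
    rw [norm_mul, Complex.norm_real, Pi.zero_apply, zero_sub, norm_neg]
    exact mul_le_mul_of_nonneg_left (norm_le_pi_norm x j) (norm_nonneg _)
  have h3 : ‖fun i => (O.b t i : ℂ)‖ ≤ ‖O.b t‖ :=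
    (pi_norm_le_iff_of_nonneg (norm_nonneg _)).2 fun i => by
      rw [Complex.norm_real]; exact norm_le_pi_norm _ i
  have h4 : ‖(O.impulse δ t : ℂ)‖ ≤ |1 / δ| := by
    rw [Complex.norm_real]; exact O.impulse_bound δ t
  refine (norm_add_le _ _).trans ?_
  rw [norm_smul, norm_mul, add_mul]
  refine add_le_add (by simpa using h1) ?_
  calc _ ≤ |1 / δ| * ((∑ j, ‖K₀ j‖) * ‖x‖) * ‖O.b t‖ := by gcongr
    _ = _ := by ring

theorem intervalIntegrable_linRhs (K₀ : Fin n → ℝ) (δ a b : ℝ) {x xt : ℝ → Fin n → ℂ}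
    (hx : Continuous x) (hxt : Continuous xt) :
    IntervalIntegrable (fun s => O.linRhs K₀ δ (s + O.T) (x s) (xt s)) volume a b := by
  have hsh : Continuous fun s : ℝ => s + O.T := by fun_prop
  have hA : Continuous fun s => (O.A (s + O.T)).map Complex.ofReal *ᵥ x s :=
    Continuous.matrix_mulVec (continuous_matrix fun i j =>
      Complex.continuous_ofReal.comp ((O.continuous_A i j).comp hsh)) hx
  have hb : Continuous fun s => (∑ j, (K₀ j : ℂ) * (xt s j - x s j)) •
      fun i => (O.b (s + O.T) i : ℂ) := by
    have h1 : Continuous fun s => ∑ j, (K₀ j : ℂ) * (xt s j - x s j) :=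
      continuous_finsetSum _ fun j _ => continuous_const.mul
        (((continuous_apply j).comp hxt).sub ((continuous_apply j).comp hx))
    exact h1.smul (continuous_pi fun i =>
      Complex.continuous_ofReal.comp ((continuous_apply i).comp (O.continuous_b.comp hsh)))
  have hm : Measurable fun s => (O.impulse δ (s + O.T) : ℂ) :=
    Complex.measurable_ofReal.comp ((O.measurable_impulse δ).comp hsh.measurable)
  refine (hA.intervalIntegrable a b).add ?_
  have hbd : ∀ s, ‖(O.impulse δ (s + O.T) : ℂ)‖ ≤ |1 / δ| := fun s => by
    rw [Complex.norm_real]; exact O.impulse_bound δ _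
  have h := hb.intervalIntegrable (μ := volume) a b
  rw [intervalIntegrable_iff] at h ⊢
  have := Integrable.bdd_smul h |1 / δ| hm.aestronglyMeasurable
    (Filter.Eventually.of_forall hbd)
  exact this.congr (Filter.Eventually.of_forall fun s =>
    smul_smul (O.impulse δ (s + O.T) : ℂ) (∑ j, (K₀ j : ℂ) * (xt s j - x s j))
      fun i => (O.b (s + O.T) i : ℂ))

/-- Every history has exactly one image under the time-`T` map. -/
theorem existsUnique_isTimeTImage (K₀ : Fin n → ℝ) (ε δ : ℝ) (φ : O.History × O.History) :
    ∃! ψ, O.IsTimeTImage K₀ ε δ φ ψ := by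
  let q : O.History := (1 - ε : ℂ) • φ.2 + (ε : ℂ) • φ.1
  have hq : Continuous (IccExtend O.neg_T_le q) := q.continuous.Icc_extend'
  have hsh : Continuous fun s : ℝ => s + O.T := by fun_prop
  obtain ⟨C, hC⟩ := exists_bound (fun t => (∑ i, ∑ j, ‖O.A (t + O.T) i j‖) +
      |1 / δ| * (∑ j, ‖K₀ j‖) * ‖O.b (t + O.T)‖)
    ((continuous_finsetSum _ fun i _ => continuous_finsetSum _ fun j _ =>
      ((O.continuous_A i j).comp hsh).norm).add
      (continuous_const.mul (O.continuous_b.comp hsh).norm)) (-O.T) 0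
  obtain ⟨p, hp, hu⟩ := existsUnique_isSolution O.neg_T_le
    (fun s x => O.linRhs K₀ δ (s + O.T) x (IccExtend O.neg_T_le q s)) C
    (fun t ht x y => by
      rw [linRhs_sub, sub_self]
      exact (O.norm_linRhs_le K₀ δ _ _).trans
        (mul_le_mul_of_nonneg_right (hC t ht) (norm_nonneg _)))
    (fun x hx => O.intervalIntegrable_linRhs K₀ δ _ _ hx hq) (φ.1 O.final)
  refine ⟨(p, q), ⟨fun s => rfl, hp⟩, fun ψ hψ => ?_⟩
  have h2 : ψ.2 = q := ContinuousMap.ext fun s => hψ.snd_eq s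
  refine Prod.ext (hu _ ?_) h2
  have := hψ.fst_eq
  rwa [h2] at this

theorem IsTimeTImage.mem_phaseSpace {K₀ : Fin n → ℝ} {ε δ : ℝ} {φ ψ : O.History × O.History}
    (h : O.IsTimeTImage K₀ ε δ φ ψ) (hφ : φ ∈ O.phaseSpace ε) : ψ ∈ O.phaseSpace ε := by
  have h1 : ψ.1 O.start = φ.1 O.final := by
    have := h.fst_eq O.start
    simpa [start] using this
  have h2 : φ.2 O.final = (1 - ε : ℂ) • φ.2 O.start + (ε : ℂ) • φ.1 O.start := hφ
  change ψ.2 O.final = (1 - ε : ℂ) • ψ.2 O.start + (ε : ℂ) • ψ.1 O.start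
  rw [h1, h.snd_eq, h.snd_eq, ← h2]

theorem IsTimeTImage.add {K₀ : Fin n → ℝ} {ε δ : ℝ} {φ ψ φ' ψ' : O.History × O.History}
    (h : O.IsTimeTImage K₀ ε δ φ ψ) (h' : O.IsTimeTImage K₀ ε δ φ' ψ') :
    O.IsTimeTImage K₀ ε δ (φ + φ') (ψ + ψ') := by
  refine ⟨fun s => ?_, fun t => ?_⟩
  · simp only [Prod.fst_add, Prod.snd_add, ContinuousMap.add_apply]
    rw [h.snd_eq, h'.snd_eq]
    module
  · simp only [Prod.fst_add, Prod.snd_add, ContinuousMap.add_apply]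
    rw [h.fst_eq t, h'.fst_eq t, add_add_add_comm, ← intervalIntegral.integral_add
      (O.intervalIntegrable_linRhs K₀ δ _ _ ψ.1.continuous.Icc_extend' ψ.2.continuous.Icc_extend')
      (O.intervalIntegrable_linRhs K₀ δ _ _ ψ'.1.continuous.Icc_extend'
        ψ'.2.continuous.Icc_extend')]
    congr 1
    refine intervalIntegral.integral_congr fun s _ => ?_
    exact (O.linRhs_add K₀ δ _ _ _ _ _).symm

theorem IsTimeTImage.smul {K₀ : Fin n → ℝ} {ε δ : ℝ} {φ ψ : O.History × O.History}
    (h : O.IsTimeTImage K₀ ε δ φ ψ) (c : ℂ) : O.IsTimeTImage K₀ ε δ (c • φ) (c • ψ) := by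
  refine ⟨fun s => ?_, fun t => ?_⟩
  · simp only [Prod.smul_fst, Prod.smul_snd, ContinuousMap.smul_apply]
    rw [h.snd_eq]
    module
  · simp only [Prod.smul_fst, Prod.smul_snd, ContinuousMap.smul_apply]
    rw [h.fst_eq t, smul_add, ← intervalIntegral.integral_smul]
    congr 1
    refine intervalIntegral.integral_congr fun s _ => ?_
    exact (O.linRhs_smul K₀ δ _ _ _ _).symm

/-- The time-`T` map (monodromy operator) of the linearisation along `x = x̃ = xs` of
`x' = f(x, Δ_δ(t) K₀ᵀ(x̃ - x))`, `x̃(t) = (1 - ε) x̃(t - T) + ε x(t - T)`, on the phase space. -/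
noncomputable def timeTMap (K₀ : Fin n → ℝ) (ε δ : ℝ) : Module.End ℂ (O.phaseSpace ε) where
  toFun φ := ⟨(O.existsUnique_isTimeTImage K₀ ε δ φ).choose,
    (O.existsUnique_isTimeTImage K₀ ε δ φ).choose_spec.1.mem_phaseSpace O φ.2⟩
  map_add' φ φ' := Subtype.ext <| (O.existsUnique_isTimeTImage K₀ ε δ _).unique
    (O.existsUnique_isTimeTImage K₀ ε δ _).choose_spec.1
    (IsTimeTImage.add O (O.existsUnique_isTimeTImage K₀ ε δ φ).choose_spec.1
      (O.existsUnique_isTimeTImage K₀ ε δ φ').choose_spec.1)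
  map_smul' c φ := Subtype.ext <| (O.existsUnique_isTimeTImage K₀ ε δ _).unique
    (O.existsUnique_isTimeTImage K₀ ε δ _).choose_spec.1
    (IsTimeTImage.smul O (O.existsUnique_isTimeTImage K₀ ε δ φ).choose_spec.1 c)

/-- Floquet multipliers: the eigenvalues of the time-`T` map of the linearisation. -/
def IsFloquetMultiplier (K₀ : Fin n → ℝ) (ε δ : ℝ) (lam : ℂ) : Prop :=
  Module.End.HasEigenvalue (R := ℂ) (M := O.phaseSpace ε) (O.timeTMap K₀ ε δ) lam

/-- Simple Floquet multipliers: eigenvalues of algebraic multiplicity one, that is, with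
a one-dimensional generalised eigenspace. -/
def IsSimpleFloquetMultiplier (K₀ : Fin n → ℝ) (ε δ : ℝ) (lam : ℂ) : Prop :=
  O.IsFloquetMultiplier K₀ ε δ lam ∧
    Module.finrank ℂ (Module.End.maxGenEigenspace (R := ℂ) (M := O.phaseSpace ε)
      (O.timeTMap K₀ ε δ) lam) = 1

end ControlledOrbit

end DelayedFeedback

/-!
# Floquet multipliers of near-impulse time-delayed feedback

Let `Φ` be the fundamental matrix of `y' = A(t) y` and `Ψ` its inverse. In the coordinates `u = Ψ x`
the linearised equation reads `u' = Ψ b Δ_δ K₀ᵀ (x̃ - x)`, so `u` moves only on `[0, δ]`, and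
`x(T) = P₀ u(δ)` (`ControlledOrbit.variation_of_constants`, `IsTimeTImage.exists_pulse`).

An eigenvector for a multiplier `lam` with `|lam| ≥ 1` has `x̃ = ε / (lam - 1 + ε) x`; hence
`x̃ - x = -κ x` with `κ = (lam - 1) / (lam - 1 + ε)`, and `|κ - 1| ≤ 1`. With `v = x(0)`, the
eigenvalue equation becomes `lam v = P₀ (v - κ q)`. After rescaling the impulse to unit length,
Grönwall's inequality gives `q → g(κ) (K₀ᵀ v) b(0)` as `δ → 0`, uniformly in such `κ`, where
`g(κ) = ∫_0^1 e^{-κsτ} dτ` and `s = K₀ᵀ b(0)` (`exists_approx_impulse`).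

The velocity of the orbit is a fixed vector of `P₀`, so there is a left fixed vector `w`. The
spectral hypothesis on `P₀ exp(-b(0) K₀ᵀ) = P₀ (1 - g(1) b(0) K₀ᵀ)` implies that `wᵀ b(0) ≠ 0` and
that no nonzero fixed vector `v` of `P₀` has `K₀ᵀ v = 0`. Pairing the eigenvalue equation with `w`
and dividing by `κ` gives `(lam - 1 + ε) wᵀ v = -wᵀ q`. In the limit `ε, δ → 0` this, the
eigenvalue equation and `κ (lam - 1) = lam - 1` are incompatible with `v ≠ 0`: if `κ = 1`, then
`lam` is an eigenvalue of `P₀ exp(-b(0) K₀ᵀ)`; if `lam = 1`, then `g(κ) (K₀ᵀ v) (wᵀ b(0)) = 0`,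
while `g` has no zero in the disc `|κ - 1| ≤ 1`, so `K₀ᵀ v = 0` and `v` is a fixed vector of `P₀`.
A compactness argument (`eq_zero_of_approx_multiplier`) makes this uniform for small `ε` and `δ`.

A Jordan chain of length two for the multiplier `1` satisfies the same equations with `lam = 1` and
`κ = 0`, and is excluded by the same lemma. The eigenspace of `1` is one-dimensional because `K₀ᵀ`
is injective on the fixed vectors of `P₀`.
-/

namespace DelayedFeedback

/-! ### The function `(e^z - 1) / z` and exponentials of rank-one matrices -/

/-- The entire function `dslope Complex.exp 0` is `z ↦ (e^z - 1) / z`, with value `1` at `0`. It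
enters because `τ * dslope Complex.exp 0 (c * τ) = ∫_0^τ e^{cσ} dσ`. -/
theorem mul_dslope_exp (z : ℂ) : z * dslope Complex.exp 0 z = Complex.exp z - 1 := by
  have h := sub_smul_dslope Complex.exp 0 z
  simpa using h

theorem dslope_exp_zero : dslope Complex.exp 0 0 = 1 := by
  rw [dslope_same, Complex.deriv_exp, Complex.exp_zero]

theorem continuous_dslope_exp : Continuous (dslope Complex.exp 0) := by
  rw [← continuousOn_univ, continuousOn_dslope Filter.univ_mem]
  exact ⟨Complex.continuous_exp.continuousOn, Complex.differentiableAt_exp⟩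

/-- The zeros of `(e^z - 1) / z` are the nonzero integer multiples of `2πi`. For real `s`, a `κ`
with `κ s` purely imaginary lies in the closed disc of radius `1` around `1` only if `κ s = 0`. -/
theorem dslope_exp_ne_zero {κ : ℂ} (hκ : ‖κ - 1‖ ≤ 1) (s : ℝ) :
    dslope Complex.exp 0 (-(κ * s)) ≠ 0 := by
  intro h
  have h1 := mul_dslope_exp (-(κ * s))
  rw [h, mul_zero] at h1
  have h2 : Complex.exp (-(κ * s)) = 1 := (sub_eq_zero.1 h1.symm)
  obtain ⟨m, hm⟩ := Complex.exp_eq_one_iff.1 h2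
  have hre : κ.re * s = 0 := by
    have := congrArg Complex.re hm
    simpa using this
  have h0 : κ * s = 0 := by
    rcases mul_eq_zero.1 hre with hk | hs
    · have : κ = 0 := by
        have hsq : ‖κ - 1‖ ^ 2 ≤ 1 := by nlinarith [norm_nonneg (κ - 1)]
        rw [Complex.sq_norm, Complex.normSq_apply] at hsq
        simp [hk] at hsq
        exact Complex.ext hk (mul_self_eq_zero.1 (le_antisymm hsq (mul_self_nonneg _)))
      simp [this]
    · simp [hs]
  rw [h0, neg_zero, dslope_exp_zero] at h
  exact one_ne_zero h

theorem hasDerivAt_mul_dslope_exp (c : ℂ) (t : ℝ) :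
    HasDerivAt (fun τ : ℝ => (τ : ℂ) * dslope Complex.exp 0 (c * τ)) (Complex.exp (c * t)) t := by
  have hid : HasDerivAt (fun τ : ℝ => (τ : ℂ)) 1 t := Complex.ofRealCLM.hasDerivAt
  by_cases hc : c = 0
  · simpa [hc, dslope_exp_zero] using hid
  · have h : (fun τ : ℝ => (τ : ℂ) * dslope Complex.exp 0 (c * τ)) =
        fun τ : ℝ => (Complex.exp (c * τ) - 1) / c := by
      funext τ
      rw [← mul_dslope_exp]
      field_simp
    rw [h]
    have := (((hid.const_mul c).cexp).sub_const 1).div_const c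
    refine this.congr_deriv ?_
    field_simp

/-- The exponential of a rank-one matrix, from `(b Kᵀ)^(k+1) = (Kᵀ b)^k b Kᵀ`. -/
theorem exp_neg_vecMulVec {n : ℕ} (b K : Fin n → ℝ) :
    ∃ γ : ℝ, NormedSpace.exp (-Matrix.vecMulVec b K) = 1 - γ • Matrix.vecMulVec b K ∧
      (γ : ℂ) = dslope Complex.exp 0 (-((K ⬝ᵥ b : ℝ) : ℂ)) := by
  set s : ℝ := K ⬝ᵥ b with hs
  set N := Matrix.vecMulVec b K with hN
  have hpow : ∀ k : ℕ, (-N) ^ (k + 1) = (-((-s) ^ k)) • N := by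
    intro k
    induction k with
    | zero => simp
    | succ k ih =>
      rw [pow_succ, ih]
      have : N * N = s • N := by
        rw [hN, Matrix.vecMulVec_mul_vecMulVec, ← hs, Matrix.vecMulVec_smul]
      rw [mul_neg, smul_mul_assoc, this, smul_smul, ← neg_smul]
      congr 1
      ring
  have hsum : HasSum (fun k : ℕ => ((k + 1).factorial : ℝ)⁻¹ * (-s) ^ k)
      (dslope Real.exp 0 (-s)) := by
    have hE : HasSum (fun k : ℕ => (k.factorial : ℝ)⁻¹ * (-s) ^ k) (Real.exp (-s)) := by
      have := NormedSpace.exp_series_hasSum_exp' (𝕂 := ℝ) (-s)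
      rw [← Real.exp_eq_exp_ℝ] at this
      simpa using this
    by_cases h0 : s = 0
    · rw [h0, neg_zero, dslope_same, Real.deriv_exp, Real.exp_zero]
      convert hasSum_ite_eq (0 : ℕ) (1 : ℝ) using 2 with k
      cases k <;> simp
    · have h1 := (hasSum_nat_add_iff' 1).2 hE
      have h2 := h1.mul_left (-s)⁻¹
      have hne : -s ≠ 0 := neg_ne_zero.2 h0
      have h3 := sub_smul_dslope Real.exp 0 (-s)
      have : dslope Real.exp 0 (-s) = (-s)⁻¹ * (Real.exp (-s) - 1) := by
        rw [eq_inv_mul_iff_mul_eq₀ hne]; simpa using h3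
      rw [this]
      have h4 : ∀ k : ℕ, (-s)⁻¹ * (((k + 1).factorial : ℝ)⁻¹ * (-s) ^ (k + 1)) =
          ((k + 1).factorial : ℝ)⁻¹ * (-s) ^ k := fun k => by
        rw [pow_succ]; field_simp
      simpa only [h4, Finset.sum_range_one, Nat.factorial_zero, Nat.cast_one, inv_one, pow_zero,
        one_mul] using h2
  refine ⟨dslope Real.exp 0 (-s), ?_, ?_⟩
  · have h1 : HasSum (fun k : ℕ => ((k.factorial : ℝ)⁻¹) • (-N) ^ k) (NormedSpace.exp (-N)) := by
      let : NormedRing (Matrix (Fin n) (Fin n) ℝ) := Matrix.linftyOpNormedRing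
      let : NormedAlgebra ℝ (Matrix (Fin n) (Fin n) ℝ) := Matrix.linftyOpNormedAlgebra
      exact NormedSpace.exp_series_hasSum_exp' (𝕂 := ℝ) (-N)
    have h2 : HasSum (fun k : ℕ => (((k + 1).factorial : ℝ)⁻¹) • (-N) ^ (k + 1))
        (-(dslope Real.exp 0 (-s) • N)) := by
      have h0 : ∀ k : ℕ, (((k + 1).factorial : ℝ)⁻¹) • (-N) ^ (k + 1) =
          -((((k + 1).factorial : ℝ)⁻¹ * (-s) ^ k) • N) := fun k => by
        rw [hpow, smul_smul, ← neg_smul]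
        congr 1; ring
      simpa only [h0] using (hsum.smul_const N).neg
    have h3 := (hasSum_nat_add_iff (f := fun k : ℕ => ((k.factorial : ℝ)⁻¹) • (-N) ^ k) 1).1 h2
    have h4 := h1.unique h3
    rw [h4]
    simp [sub_eq_neg_add]
  · have h3 := sub_smul_dslope Real.exp 0 (-s)
    by_cases h0 : s = 0
    · simp [h0]
    · have hne : -(s : ℂ) ≠ 0 := by exact_mod_cast neg_ne_zero.2 h0
      apply mul_left_cancel₀ hne
      rw [mul_dslope_exp]
      have : -s * dslope Real.exp 0 (-s) = Real.exp (-s) - 1 := by simpa using h3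
      exact_mod_cast congrArg Complex.ofReal this

/-! ### Approximate multiplier equations -/

theorem tendsto_dotProduct {n : ℕ} {v : ℕ → Fin n → ℂ} {v0 : Fin n → ℂ} (a : Fin n → ℂ)
    (h : Filter.Tendsto v Filter.atTop (nhds v0)) :
    Filter.Tendsto (fun k => a ⬝ᵥ v k) Filter.atTop (nhds (a ⬝ᵥ v0)) :=
  ((Continuous.dotProduct (continuous_const (y := a)) continuous_id).tendsto v0).comp h

/-- If `lam` is a multiplier, then `x̃ - x = -κ x` along the eigensolution, with
`κ = (lam - 1) / (lam - 1 + ε)`. Outside the open unit disc `lam - 1 + ε` has modulus at least `ε`,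
which confines `κ` to the closed disc of radius `1` around `1`. -/
theorem norm_feedbackFactor_sub_one_le {ε : ℝ} (hε : 0 < ε) (hε1 : ε < 1) {lam : ℂ}
    (hlam : 1 ≤ ‖lam‖) :
    lam - 1 + ε ≠ 0 ∧ ‖(lam - 1) / (lam - 1 + ε) - 1‖ ≤ 1 := by
  have h1 : ε ≤ ‖lam - 1 + ε‖ := by
    have h2 : ‖((1 - ε : ℝ) : ℂ)‖ = 1 - ε := by
      rw [Complex.norm_real, Real.norm_of_nonneg (by linarith)]
    have h3 := norm_sub_norm_le lam ((1 - ε : ℝ) : ℂ)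
    have h4 : lam - ((1 - ε : ℝ) : ℂ) = lam - 1 + ε := by push_cast; ring
    rw [h4, h2] at h3
    linarith
  have h0 : lam - 1 + ε ≠ 0 := by
    intro h
    rw [h, norm_zero] at h1
    linarith
  refine ⟨h0, ?_⟩
  have : (lam - 1) / (lam - 1 + ε) - 1 = -(ε : ℂ) / (lam - 1 + ε) := by
    field_simp
    ring
  rw [this, norm_div, norm_neg, Complex.norm_real, Real.norm_of_nonneg hε.le]
  exact div_le_one_of_le₀ h1 (norm_nonneg _)

/-- The compactness argument. Here `v` is the initial value of an eigensolution, `κ q` the total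
kick of the impulse, and `w` a left fixed vector of `P`; the scalar equation is the eigenvalue equation
paired with `w` and divided by `κ`, which keeps it informative as `κ → 0`. A sequence of
counterexamples would converge to a solution of the equations with `ε = η = 0`. There
`κ (lam - 1) = lam - 1`: either `κ = 1`, which `hH` excludes, or `lam = 1`, when the scalar equation
forces `K ⬝ᵥ v = 0`, and again `hH` applies. -/
theorem eq_zero_of_approx_multiplier {n : ℕ} (P : Matrix (Fin n) (Fin n) ℂ) (b K w : Fin n → ℂ)
    (s : ℝ)
    (hH : ∀ (lam : ℂ) (v : Fin n → ℂ), 1 ≤ ‖lam‖ →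
      lam • v = P *ᵥ (v - (dslope Complex.exp 0 (-(s : ℂ)) * (K ⬝ᵥ v)) • b) → v = 0)
    (hwb : w ⬝ᵥ b ≠ 0) :
    ∃ ε₀ > 0, ∃ η₀ > 0, ∀ ε : ℝ, 0 < ε → ε < ε₀ → ∀ (lam : ℂ) (v q : Fin n → ℂ), 1 ≤ ‖lam‖ →
      lam • v = P *ᵥ (v - ((lam - 1) / (lam - 1 + ε)) • q) →
      (lam - 1 + ε) * (w ⬝ᵥ v) = -(w ⬝ᵥ q) →
      ‖q - (dslope Complex.exp 0 (-((lam - 1) / (lam - 1 + ε) * s)) * (K ⬝ᵥ v)) • b‖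
        ≤ η₀ * ‖v‖ → v = 0 := by
  by_contra! hcon
  have hpos : ∀ k : ℕ, (0 : ℝ) < 1 / ((k : ℝ) + 2) := fun k => by positivity
  choose e he0 he1 lam v q hlam hev hw hq hv using
    fun k : ℕ => hcon (1 / ((k : ℝ) + 2)) (hpos k) (1 / ((k : ℝ) + 2)) (hpos k)
  have hnv : ∀ k, ‖v k‖ ≠ 0 := fun k => norm_ne_zero_iff.2 (hv k)
  have he12 : ∀ k, e k < 1 := fun k => (he1 k).trans_le (by
    rw [div_le_one (by positivity)]; linarith [(Nat.cast_nonneg k : (0 : ℝ) ≤ k)])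
  let κ : ℕ → ℂ := fun k => (lam k - 1) / (lam k - 1 + e k)
  have hκ : ∀ k, ‖κ k - 1‖ ≤ 1 := fun k =>
    (norm_feedbackFactor_sub_one_le (he0 k) (he12 k) (hlam k)).2
  -- Normalise so that `‖v‖ = 1`.
  let V : ℕ → Fin n → ℂ := fun k => ((‖v k‖⁻¹ : ℝ) : ℂ) • v k
  let Q : ℕ → Fin n → ℂ := fun k => ((‖v k‖⁻¹ : ℝ) : ℂ) • q k
  have hV1 : ∀ k, ‖V k‖ = 1 := fun k => by
    simp only [V, norm_smul, Complex.norm_real, norm_inv, norm_norm]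
    exact inv_mul_cancel₀ (hnv k)
  have hVev : ∀ k, lam k • V k = P *ᵥ (V k - κ k • Q k) := fun k => by
    simp only [V, Q]
    rw [smul_comm, hev k, smul_comm (κ k), ← smul_sub, Matrix.mulVec_smul]
  have hVw : ∀ k, (lam k - 1 + e k) * (w ⬝ᵥ V k) = -(w ⬝ᵥ Q k) := fun k => by
    simp only [V, Q, dotProduct_smul, smul_eq_mul]
    linear_combination ((‖v k‖⁻¹ : ℝ) : ℂ) * hw k
  have hVq : ∀ k, ‖Q k - (dslope Complex.exp 0 (-(κ k * s)) * (K ⬝ᵥ V k)) • b‖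
      ≤ 1 / ((k : ℝ) + 2) := fun k => by
    have h1 : Q k - (dslope Complex.exp 0 (-(κ k * s)) * (K ⬝ᵥ V k)) • b =
        ((‖v k‖⁻¹ : ℝ) : ℂ) • (q k - (dslope Complex.exp 0 (-(κ k * s)) * (K ⬝ᵥ v k)) • b) := by
      simp only [V, Q, dotProduct_smul, smul_eq_mul]
      module
    rw [h1, norm_smul, Complex.norm_real, norm_inv, norm_norm]
    calc ‖v k‖⁻¹ * _ ≤ ‖v k‖⁻¹ * (1 / ((k : ℝ) + 2) * ‖v k‖) :=
          mul_le_mul_of_nonneg_left (hq k) (by positivity)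
      _ = _ := by field_simp [hnv k]
  -- Along a subsequence `(κ, v)` converges; `q`, the multipliers and `ε` converge along with it.
  obtain ⟨⟨κ₀, v₀⟩, -, σ, hσ, hlim⟩ :=
    ((isCompact_closedBall (1 : ℂ) 1).prod (isCompact_closedBall (0 : Fin n → ℂ) 1)).tendsto_subseq
      (x := fun k => (κ k, V k)) (fun k => ⟨by simpa [dist_eq_norm] using hκ k,
        by simp [hV1 k]⟩)
  have hκl : Filter.Tendsto (fun k => κ (σ k)) Filter.atTop (nhds κ₀) :=
    (continuous_fst.tendsto _).comp hlim
  have hvl : Filter.Tendsto (fun k => V (σ k)) Filter.atTop (nhds v₀) :=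
    (continuous_snd.tendsto _).comp hlim
  have hz : Filter.Tendsto (fun k : ℕ => 1 / ((k : ℝ) + 2)) Filter.atTop (nhds 0) :=
    tendsto_const_nhds.div_atTop
      (Filter.tendsto_atTop_add_const_right _ _ tendsto_natCast_atTop_atTop)
  have hel : Filter.Tendsto (fun k => (e (σ k) : ℂ)) Filter.atTop (nhds 0) := by
    have h1 : Filter.Tendsto e Filter.atTop (nhds 0) :=
      squeeze_zero (fun k => (he0 k).le) (fun k => (he1 k).le) hz
    have := (Complex.continuous_ofReal.tendsto 0).comp (h1.comp hσ.tendsto_atTop)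
    simpa [Function.comp_def] using this
  set q₀ : Fin n → ℂ := (dslope Complex.exp 0 (-(κ₀ * s)) * (K ⬝ᵥ v₀)) • b with hq₀
  have hql : Filter.Tendsto (fun k => Q (σ k)) Filter.atTop (nhds q₀) := by
    have h1 : Filter.Tendsto (fun k => Q (σ k) -
        (dslope Complex.exp 0 (-(κ (σ k) * s)) * (K ⬝ᵥ V (σ k))) • b) Filter.atTop (nhds 0) :=
      squeeze_zero_norm (fun k => hVq (σ k)) (hz.comp hσ.tendsto_atTop)
    have h2 : Filter.Tendsto (fun k =>
        (dslope Complex.exp 0 (-(κ (σ k) * s)) * (K ⬝ᵥ V (σ k))) • b) Filter.atTop (nhds q₀) :=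
      (((continuous_dslope_exp.tendsto _).comp (hκl.mul_const (s : ℂ)).neg).mul
        (tendsto_dotProduct K hvl)).smul_const b
    simpa using h1.add h2
  have hv1 : ‖v₀‖ = 1 := by
    have h1 := hvl.norm
    simp only [hV1] at h1
    exact tendsto_nhds_unique h1 tendsto_const_nhds |>.symm ▸ rfl
  have hv0 : v₀ ≠ 0 := fun h => by simp [h] at hv1
  -- The multipliers converge too, because one coordinate of the limit of `v` is nonzero.
  obtain ⟨i, hi⟩ : ∃ i, v₀ i ≠ 0 := by
    by_contra! h
    exact hv0 (funext h)
  have hPl : Filter.Tendsto (fun k => P *ᵥ (V (σ k) - κ (σ k) • Q (σ k))) Filter.atTop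
      (nhds (P *ᵥ (v₀ - κ₀ • q₀))) :=
    ((Continuous.matrix_mulVec (continuous_const (y := P)) continuous_id).tendsto _).comp
      (hvl.sub (hκl.smul hql))
  obtain ⟨l, hl⟩ : ∃ l, Filter.Tendsto (fun k => lam (σ k)) Filter.atTop (nhds l) := by
    have h1 := ((continuous_apply i).tendsto _).comp hPl
    have h2 := ((continuous_apply i).tendsto _).comp hvl
    refine ⟨_, (h1.div h2 hi).congr' ?_⟩
    filter_upwards [h2.eventually_ne hi] with k hk
    have h3 := congrFun (hVev (σ k)) i
    simp only [Pi.smul_apply, smul_eq_mul] at h3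
    simp only [Function.comp_apply, Pi.div_apply] at hk ⊢
    rw [← h3, mul_div_cancel_right₀ _ hk]
  have hl1 : 1 ≤ ‖l‖ := ge_of_tendsto' hl.norm fun k => hlam (σ k)
  have hevl : l • v₀ = P *ᵥ (v₀ - κ₀ • q₀) :=
    tendsto_nhds_unique ((hl.smul hvl).congr fun k => hVev (σ k)) hPl
  have hwl : (l - 1 + 0) * (w ⬝ᵥ v₀) = -(w ⬝ᵥ q₀) :=
    tendsto_nhds_unique ((((hl.sub_const 1).add hel).mul (tendsto_dotProduct w hvl)).congr
      fun k => hVw (σ k)) (tendsto_dotProduct w hql).neg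
  have hκ1 : ‖κ₀ - 1‖ ≤ 1 := le_of_tendsto' (hκl.sub_const 1).norm fun k => hκ (σ k)
  have hκlam : κ₀ * (l - 1 + 0) = l - 1 :=
    tendsto_nhds_unique ((hκl.mul ((hl.sub_const 1).add hel)).congr fun k =>
      div_mul_cancel₀ _ (norm_feedbackFactor_sub_one_le (he0 _) (he12 _) (hlam _)).1)
      (hl.sub_const 1)
  have hor : l = 1 ∨ κ₀ = 1 := by
    have : (κ₀ - 1) * (l - 1) = 0 := by linear_combination hκlam
    rcases mul_eq_zero.1 this with h | h
    · exact Or.inr (sub_eq_zero.1 h)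
    · exact Or.inl (sub_eq_zero.1 h)
  rcases hor with h | h
  · rw [h, sub_self, add_zero, zero_mul, eq_comm, neg_eq_zero, hq₀, dotProduct_smul, smul_eq_mul,
      mul_eq_zero, mul_eq_zero] at hwl
    rcases hwl with (h1 | h1) | h1
    · exact dslope_exp_ne_zero hκ1 s h1
    · refine hv0 (hH 1 v₀ (by simp) ?_)
      rw [hq₀, h1, h] at hevl
      simpa [h1] using hevl
    · exact hwb h1
  · refine hv0 (hH l v₀ hl1 ?_)
    rw [hevl, hq₀, h, one_smul, one_mul]

/-! ### Short impulses -/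

theorem norm_dotProduct_le {n : ℕ} (a v : Fin n → ℂ) : ‖a ⬝ᵥ v‖ ≤ n * ‖a‖ * ‖v‖ := by
  calc ‖∑ i, a i * v i‖ ≤ ∑ _i : Fin n, ‖a‖ * ‖v‖ := by
        refine (norm_sum_le _ _).trans (Finset.sum_le_sum fun i _ => ?_)
        rw [norm_mul]
        exact mul_le_mul (norm_le_pi_norm a i) (norm_le_pi_norm v i) (norm_nonneg _) (norm_nonneg _)
    _ = _ := by simp [mul_assoc]

theorem norm_rankOne_sub_le {n : ℕ} (β β₀ l l₀ x : Fin n → ℂ) :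
    ‖(l ⬝ᵥ x) • β - (l₀ ⬝ᵥ x) • β₀‖ ≤ n * (‖l‖ * ‖β - β₀‖ + ‖l - l₀‖ * ‖β₀‖) * ‖x‖ := by
  have h : (l ⬝ᵥ x) • β - (l₀ ⬝ᵥ x) • β₀ = (l ⬝ᵥ x) • (β - β₀) + ((l - l₀) ⬝ᵥ x) • β₀ := by
    rw [sub_dotProduct]; module
  rw [h]
  refine (norm_add_le _ _).trans ?_
  rw [norm_smul, norm_smul]
  have h1 := norm_dotProduct_le l x
  have h2 := norm_dotProduct_le (l - l₀) x
  calc _ ≤ (n * ‖l‖ * ‖x‖) * ‖β - β₀‖ + (n * ‖l - l₀‖ * ‖x‖) * ‖β₀‖ := by gcongr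
    _ = _ := by ring

/-- The rank-one operators `x ↦ (l(t) ⬝ᵥ x) β(t)` are close in norm to their value at `t = 0`. -/
theorem exists_rankOne_close {n : ℕ} {β l : ℝ → Fin n → ℂ} (hβ : Continuous β) (hl : Continuous l)
    {η : ℝ} (hη : 0 < η) :
    ∃ δ₀ > 0, ∀ t, 0 ≤ t → t < δ₀ → ∀ x : Fin n → ℂ,
      ‖(l t ⬝ᵥ x) • β t - (l 0 ⬝ᵥ x) • β 0‖ ≤ η * ‖x‖ := by
  have hc : Continuous fun t => n * (‖l t‖ * ‖β t - β 0‖ + ‖l t - l 0‖ * ‖β 0‖) := by fun_prop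
  have h0 : n * (‖l 0‖ * ‖β 0 - β 0‖ + ‖l 0 - l 0‖ * ‖β 0‖) < η := by simpa using hη
  obtain ⟨δ₀, hδ₀, h⟩ := Metric.eventually_nhds_iff.1 ((hc.tendsto 0).eventually (gt_mem_nhds h0))
  refine ⟨δ₀, hδ₀, fun t ht ht' x => (norm_rankOne_sub_le _ _ _ _ _).trans ?_⟩
  refine mul_le_mul_of_nonneg_right (h ?_).le (norm_nonneg _)
  rwa [Real.dist_eq, sub_zero, abs_of_nonneg ht]

theorem hasDerivWithinAt_Ici_of_Icc {E : Type*} [NormedAddCommGroup E] [NormedSpace ℝ E]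
    {f : ℝ → E} {f' : E} {a b t : ℝ} (h : HasDerivWithinAt f f' (Icc a b) t) (ht : t ∈ Ico a b) :
    HasDerivWithinAt f f' (Ici t) t :=
  h.mono_of_mem_nhdsWithin (Icc_mem_nhdsGE_of_mem ht)

/-- Limit of a short strong impulse: as `δ → 0`, the time-one map of `U' = -κ (l(δτ) ⬝ᵥ U) β(δτ)`
tends to that of the autonomous equation, `v ↦ v - κ (e^{-κs} - 1) / (-κs) (l(0) ⬝ᵥ v) β(0)`. The
error carries the factor `‖κ‖`, as the kick has to be divided by `κ` afterwards. -/
theorem exists_approx_impulse {n : ℕ} {β l : ℝ → Fin n → ℂ} (hβ : Continuous β)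
    (hl : Continuous l) (s : ℝ) (hs : l 0 ⬝ᵥ β 0 = s) {η : ℝ} (hη : 0 < η) :
    ∃ δ₀ > 0, ∀ δ, 0 < δ → δ < δ₀ → ∀ (κ : ℂ), ‖κ‖ ≤ 2 → ∀ U : ℝ → Fin n → ℂ,
      (∀ τ ∈ Icc (0 : ℝ) 1,
        HasDerivWithinAt U (-(κ * (l (δ * τ) ⬝ᵥ U τ)) • β (δ * τ)) (Icc 0 1) τ) →
      ‖U 1 - (U 0 - (κ * (dslope Complex.exp 0 (-(κ * s)) * (l 0 ⬝ᵥ U 0))) • β 0)‖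
        ≤ η * ‖κ‖ * ‖U 0‖ := by
  -- A bound for `z / ‖v‖`, where `z` solves the limit equation with `z(0) = v`.
  obtain ⟨D, hD⟩ := ((isCompact_Icc (a := (0 : ℝ)) (b := 1)).prod
    (isCompact_closedBall (0 : ℂ) 2)).bddAbove_image
    (f := fun p => ‖(p.1 : ℂ) * dslope Complex.exp 0 (-(p.2 * s) * p.1)‖) (by
      refine (Continuous.norm ((Complex.continuous_ofReal.comp continuous_fst).mul
        (continuous_dslope_exp.comp ?_))).continuousOn
      fun_prop)
  have hD' : ∀ τ ∈ Icc (0 : ℝ) 1, ∀ κ : ℂ, ‖κ‖ ≤ 2 →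
      ‖(τ : ℂ) * dslope Complex.exp 0 (-(κ * s) * τ)‖ ≤ D := fun τ hτ κ hκ =>
    hD ⟨(τ, κ), ⟨hτ, by simpa using hκ⟩, rfl⟩
  have hD0 : 0 ≤ D := (norm_nonneg _).trans (hD' 0 (by simp) 0 (by simp))
  set C : ℝ := 1 + 2 * (D * (n * ‖l 0‖)) * ‖β 0‖ with hC
  have hC1 : 1 ≤ C := by
    have : 0 ≤ 2 * (D * (n * ‖l 0‖)) * ‖β 0‖ := by positivity
    linarith
  set L : ℝ := 2 * (1 + n * ‖l 0‖ * ‖β 0‖) with hL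
  have hL0 : 0 < L := by positivity
  set c : ℝ := C / L * (Real.exp L - 1) with hc
  have hc0 : 0 < c := by
    have : 1 < Real.exp L := Real.one_lt_exp_iff.2 hL0
    have : 0 < Real.exp L - 1 := by linarith
    positivity
  obtain ⟨δ₀, hδ₀, hclose⟩ := exists_rankOne_close hβ hl (show 0 < min 1 (η / c) by positivity)
  refine ⟨δ₀, hδ₀, fun δ hδ hδ' κ hκ U hU => ?_⟩
  have hcl : ∀ τ ∈ Icc (0 : ℝ) 1, ∀ x : Fin n → ℂ,
      ‖(l (δ * τ) ⬝ᵥ x) • β (δ * τ) - (l 0 ⬝ᵥ x) • β 0‖ ≤ min 1 (η / c) * ‖x‖ := fun τ hτ x =>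
    hclose _ (mul_nonneg hδ.le hτ.1) (by nlinarith [hτ.2]) x
  set v := U 0 with hv
  -- The solution of the limit equation `z' = -κ (l(0)·z) β(0)`, `z(0) = v`.
  let z : ℝ → Fin n → ℂ := fun τ =>
    v - (κ * (((τ : ℂ) * dslope Complex.exp 0 (-(κ * s) * τ)) * (l 0 ⬝ᵥ v))) • β 0
  have hz : ∀ τ : ℝ, HasDerivAt z (-(κ * (l 0 ⬝ᵥ z τ)) • β 0) τ := fun τ => by
    have h1 := ((((hasDerivAt_mul_dslope_exp (-(κ * s)) τ).mul_const (l 0 ⬝ᵥ v)).const_mul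
      κ).smul_const (β 0)).const_sub v
    refine h1.congr_deriv ?_
    have h2 : l 0 ⬝ᵥ z τ = Complex.exp (-(κ * s) * τ) * (l 0 ⬝ᵥ v) := by
      simp only [z, dotProduct_sub, dotProduct_smul, hs, smul_eq_mul]
      linear_combination (l 0 ⬝ᵥ v) * mul_dslope_exp (-(κ * s) * τ)
    rw [h2, neg_smul]
  have hzb : ∀ τ ∈ Icc (0 : ℝ) 1, ‖z τ‖ ≤ C * ‖v‖ := fun τ hτ => by
    refine (norm_sub_le _ _).trans ?_
    rw [norm_smul, norm_mul, norm_mul]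
    have h1 := hD' τ hτ κ hκ
    have h2 := norm_dotProduct_le (l 0) v
    calc _ ≤ ‖v‖ + 2 * (D * (n * ‖l 0‖ * ‖v‖)) * ‖β 0‖ := by gcongr
      _ = _ := by rw [hC]; ring
  have hdU : ∀ τ ∈ Icc (0 : ℝ) 1, HasDerivWithinAt (fun τ => U τ - z τ)
      (-(κ * (l (δ * τ) ⬝ᵥ U τ)) • β (δ * τ) - -(κ * (l 0 ⬝ᵥ z τ)) • β 0) (Icc 0 1) τ :=
    fun τ hτ => (hU τ hτ).sub (hz τ).hasDerivWithinAt
  have hG := norm_le_gronwallBound_of_norm_deriv_right_le (f := fun τ => U τ - z τ)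
    (f' := fun τ => -(κ * (l (δ * τ) ⬝ᵥ U τ)) • β (δ * τ) - -(κ * (l 0 ⬝ᵥ z τ)) • β 0)
    (δ := 0) (K := L) (a := 0) (b := 1)
    (ε := ‖κ‖ * (η / c) * (C * ‖v‖))
    (fun τ hτ => (hdU τ hτ).continuousWithinAt)
    (fun τ hτ => hasDerivWithinAt_Ici_of_Icc (hdU τ (Ico_subset_Icc_self hτ)) hτ)
    (by simp [z, hv]) (fun τ hτ => by
      have hτ' := Ico_subset_Icc_self hτ
      have h1 : -(κ * (l (δ * τ) ⬝ᵥ U τ)) • β (δ * τ) - -(κ * (l 0 ⬝ᵥ z τ)) • β 0 =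
          -κ • (((l (δ * τ) ⬝ᵥ (U τ - z τ)) • β (δ * τ) - (l 0 ⬝ᵥ (U τ - z τ)) • β 0) +
            (l 0 ⬝ᵥ (U τ - z τ)) • β 0 +
            ((l (δ * τ) ⬝ᵥ z τ) • β (δ * τ) - (l 0 ⬝ᵥ z τ) • β 0)) := by
        simp only [dotProduct_sub]; module
      have h2 : ‖(l (δ * τ) ⬝ᵥ (U τ - z τ)) • β (δ * τ) - (l 0 ⬝ᵥ (U τ - z τ)) • β 0‖ ≤
          1 * ‖U τ - z τ‖ := (hcl τ hτ' _).trans (by gcongr; exact min_le_left _ _)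
      have h3 : ‖(l 0 ⬝ᵥ (U τ - z τ)) • β 0‖ ≤ n * ‖l 0‖ * ‖U τ - z τ‖ * ‖β 0‖ := by
        rw [norm_smul]; gcongr; exact norm_dotProduct_le _ _
      have h4 : ‖(l (δ * τ) ⬝ᵥ z τ) • β (δ * τ) - (l 0 ⬝ᵥ z τ) • β 0‖ ≤ η / c * (C * ‖v‖) :=
        (hcl τ hτ' _).trans (by gcongr; exacts [min_le_right _ _, hzb τ hτ'])
      rw [h1, norm_smul, norm_neg]
      calc _ ≤ ‖κ‖ * (1 * ‖U τ - z τ‖ + n * ‖l 0‖ * ‖U τ - z τ‖ * ‖β 0‖ + η / c * (C * ‖v‖)) := by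
            gcongr
            exact (norm_add₃_le).trans (by gcongr)
        _ = ‖κ‖ * ((1 + n * ‖l 0‖ * ‖β 0‖) * ‖U τ - z τ‖) + ‖κ‖ * (η / c) * (C * ‖v‖) := by ring
        _ ≤ 2 * ((1 + n * ‖l 0‖ * ‖β 0‖) * ‖U τ - z τ‖) + ‖κ‖ * (η / c) * (C * ‖v‖) := by gcongr
        _ = _ := by rw [hL]; ring) 1 (by simp)
  rw [gronwallBound_of_K_ne_0 hL0.ne'] at hG
  have hz1 : z 1 = v - (κ * (dslope Complex.exp 0 (-(κ * s)) * (l 0 ⬝ᵥ v))) • β 0 := by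
    simp [z]
  rw [hz1] at hG
  refine hG.trans (le_of_eq ?_)
  have h5 : ‖κ‖ * (η / c) * (C * ‖v‖) / L * (Real.exp L - 1) = ‖κ‖ * (η / c) * ‖v‖ * c := by
    rw [hc]; ring
  simp only [zero_mul, zero_add, sub_zero, mul_one]
  rw [h5]
  field_simp

/-- The analogue of `exists_approx_impulse` for an impulse whose strength is prescribed by a fixed
vector `v` instead of by the state. -/
theorem exists_approx_forcing {n : ℕ} {β l : ℝ → Fin n → ℂ} (hβ : Continuous β)
    (hl : Continuous l) {η : ℝ} (hη : 0 < η) :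
    ∃ δ₀ > 0, ∀ δ, 0 < δ → δ < δ₀ → ∀ (c : ℂ) (v : Fin n → ℂ) (U : ℝ → Fin n → ℂ),
      (∀ τ ∈ Icc (0 : ℝ) 1,
        HasDerivWithinAt U (-(c * (l (δ * τ) ⬝ᵥ v)) • β (δ * τ)) (Icc 0 1) τ) →
      ‖U 1 - (U 0 - (c * (l 0 ⬝ᵥ v)) • β 0)‖ ≤ η * ‖c‖ * ‖v‖ := by
  obtain ⟨δ₀, hδ₀, hclose⟩ := exists_rankOne_close hβ hl hη
  refine ⟨δ₀, hδ₀, fun δ hδ hδ' c v U hU => ?_⟩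
  let g : ℝ → Fin n → ℂ := fun τ => U τ + ((τ : ℂ) * (c * (l 0 ⬝ᵥ v))) • β 0
  have hg : ∀ τ ∈ Icc (0 : ℝ) 1, HasDerivWithinAt g
      (-(c * (l (δ * τ) ⬝ᵥ v)) • β (δ * τ) + (1 * (c * (l 0 ⬝ᵥ v))) • β 0) (Icc 0 1) τ :=
    fun τ hτ => (hU τ hτ).add (((Complex.ofRealCLM.hasDerivAt (x := τ)).mul_const
      _).smul_const _).hasDerivWithinAt
  have h := norm_image_sub_le_of_norm_deriv_le_segment_01' (C := η * ‖c‖ * ‖v‖) hg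
    (fun τ hτ => by
      have h1 : -(c * (l (δ * τ) ⬝ᵥ v)) • β (δ * τ) + (1 * (c * (l 0 ⬝ᵥ v))) • β 0 =
          -c • ((l (δ * τ) ⬝ᵥ v) • β (δ * τ) - (l 0 ⬝ᵥ v) • β 0) := by module
      rw [h1, norm_smul, norm_neg]
      calc _ ≤ ‖c‖ * (η * ‖v‖) := by
            gcongr
            exact hclose _ (mul_nonneg hδ.le hτ.1) (by nlinarith [hτ.2.le]) v
        _ = _ := by ring)
  refine le_trans (le_of_eq ?_) h
  congr 1
  simp only [g, Complex.ofReal_one, Complex.ofReal_zero]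
  module

/-! ### Differentiation of integral equations -/

/-- The endpoints are left out of the hypothesis on `g` because the impulse jumps there. -/
theorem hasDerivWithinAt_of_eq_integral {E : Type*} [NormedAddCommGroup E] [NormedSpace ℝ E]
    [CompleteSpace E] {a b : ℝ} {y g h : ℝ → E} (hh : Continuous h)
    (hgh : EqOn g h (Ioo a b)) (hy : ∀ t ∈ Icc a b, y t = y a + ∫ s in a..t, g s) {t : ℝ}
    (ht : t ∈ Icc a b) : HasDerivWithinAt y (h t) (Icc a b) t := by
  have h1 : ∀ t ∈ Icc a b, y t = y a + ∫ s in a..t, h s := fun t ht => by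
    rw [hy t ht]
    congr 1
    exact intervalIntegral.integral_congr_Ioo_of_le ht.1 fun s hs =>
      hgh ⟨hs.1, hs.2.trans_le ht.2⟩
  exact (((hh.integral_hasStrictDerivAt a t).hasDerivAt.const_add (y a)).hasDerivWithinAt).congr h1
    (h1 t ht)

theorem eq_left_of_hasDerivWithinAt_zero {E : Type*} [NormedAddCommGroup E] [NormedSpace ℝ E]
    {a b : ℝ} {y : ℝ → E} (hy : ∀ t ∈ Icc a b, HasDerivWithinAt y 0 (Icc a b) t) :
    ∀ t ∈ Icc a b, y t = y a :=
  constant_of_has_deriv_right_zero (fun t ht => (hy t ht).continuousWithinAt)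
    fun t ht => hasDerivWithinAt_Ici_of_Icc (hy t (Ico_subset_Icc_self ht)) ht

theorem IsSolution.hasDerivWithinAt {E : Type*} [NormedAddCommGroup E] [NormedSpace ℝ E]
    [CompleteSpace E] {a b : ℝ} {hab : a ≤ b} {G : ℝ → E → E} {x₀ : E} {x : C(Icc a b, E)}
    (hx : IsSolution hab G x₀ x) (hG : Continuous fun t => G t (IccExtend hab x t)) {t : ℝ}
    (ht : t ∈ Icc a b) :
    HasDerivWithinAt (IccExtend hab x) (G t (IccExtend hab x t)) (Icc a b) t := by
  have h0 : IccExtend hab x a = x₀ := by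
    rw [IccExtend_of_mem hab _ (left_mem_Icc.2 hab), hx]
    simp
  refine hasDerivWithinAt_of_eq_integral (g := fun t => G t (IccExtend hab x t)) hG
    (fun s _ => rfl) (fun t ht => ?_) ht
  rw [h0, IccExtend_of_mem hab _ ht]
  exact hx ⟨t, ht⟩

/-! ### Linear algebra of the spectral hypothesis -/

/-- The spectral hypothesis in vector form, with the exponential written out: `P exp(-b Kᵀ)` has no
eigenvalue outside the open unit disc. -/
theorem eq_zero_of_smul_eq_impulseMap {n : ℕ} {P : Matrix (Fin n) (Fin n) ℝ} {b K : Fin n → ℝ}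
    {r : ℝ} (hr : r < 1)
    (hspec : ∀ z ∈ spectrum ℂ
      ((P * NormedSpace.exp (-Matrix.vecMulVec b K)).map Complex.ofReal), ‖z‖ < r)
    {lam : ℂ} {v : Fin n → ℂ} (hlam : 1 ≤ ‖lam‖)
    (hv : lam • v = P.map Complex.ofReal *ᵥ
      (v - (dslope Complex.exp 0 (-((K ⬝ᵥ b : ℝ) : ℂ)) * ((fun j => (K j : ℂ)) ⬝ᵥ v)) •
        fun i => (b i : ℂ))) : v = 0 := by
  obtain ⟨γ, hγ, hγc⟩ := exp_neg_vecMulVec b K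
  rw [hγ] at hspec
  set M := (P * (1 - γ • Matrix.vecMulVec b K)).map Complex.ofReal with hM
  have hMv : M *ᵥ v = lam • v := by
    have h1 : M = P.map Complex.ofReal *
        (1 - (γ : ℂ) • Matrix.vecMulVec (fun i => (b i : ℂ)) (fun j => (K j : ℂ))) := by
      have h2 : M = P.map Complex.ofReal * (1 - γ • Matrix.vecMulVec b K).map Complex.ofReal :=
        Matrix.map_mul (f := Complex.ofRealHom)
      rw [h2]
      congr 1
      ext i j
      simp [Matrix.vecMulVec_apply, Matrix.one_apply, apply_ite Complex.ofReal]
    rw [hv, h1, ← Matrix.mulVec_mulVec, Matrix.sub_mulVec, Matrix.one_mulVec, Matrix.smul_mulVec,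
      Matrix.vecMulVec_mulVec, hγc, op_smul_eq_smul, smul_smul]
  by_contra hv0
  refine absurd (hspec lam ?_) (by linarith)
  rw [spectrum.mem_iff]
  intro hu
  refine hv0 (Matrix.mulVec_injective_of_isUnit hu ?_)
  rw [Matrix.sub_mulVec, hMv, Matrix.mulVec_zero, Algebra.algebraMap_eq_smul_one,
    Matrix.smul_mulVec, Matrix.one_mulVec, sub_self]

/-- A left fixed vector `w` of `P` with `w ⬝ᵥ b = 0` would be a left fixed vector of
`P (1 - γ b Kᵀ)`. -/
theorem exists_left_fixed {n : ℕ} {P : Matrix (Fin n) (Fin n) ℂ} {b K v₀ : Fin n → ℂ} (γ : ℂ)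
    (hH : ∀ v : Fin n → ℂ, v = P *ᵥ (v - (γ * (K ⬝ᵥ v)) • b) → v = 0)
    (hv₀ : v₀ ≠ 0) (hP : P *ᵥ v₀ = v₀) : ∃ w, w ᵥ* P = w ∧ w ⬝ᵥ b ≠ 0 := by
  have hdet : (P - 1).det = 0 := Matrix.exists_mulVec_eq_zero_iff.1
    ⟨v₀, hv₀, by rw [Matrix.sub_mulVec, hP, Matrix.one_mulVec, sub_self]⟩
  obtain ⟨w, hw0, hw⟩ := Matrix.exists_vecMul_eq_zero_iff.2 hdet
  rw [Matrix.vecMul_sub, Matrix.vecMul_one, sub_eq_zero] at hw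
  refine ⟨w, hw, fun hwb => ?_⟩
  have hdet' : (P * (1 - γ • Matrix.vecMulVec b K) - 1).det = 0 :=
    Matrix.exists_vecMul_eq_zero_iff.1 ⟨w, hw0, by
      rw [Matrix.vecMul_sub, ← Matrix.vecMul_vecMul, hw, Matrix.vecMul_sub, Matrix.vecMul_one,
        Matrix.vecMul_smul, Matrix.vecMul_vecMulVec, hwb]
      simp⟩
  obtain ⟨v, hv0, hv⟩ := Matrix.exists_mulVec_eq_zero_iff.2 hdet'
  refine hv0 (hH v ?_)
  rw [Matrix.sub_mulVec, Matrix.one_mulVec, sub_eq_zero, ← Matrix.mulVec_mulVec,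
    Matrix.sub_mulVec, Matrix.one_mulVec, Matrix.smul_mulVec, Matrix.vecMulVec_mulVec,
    op_smul_eq_smul, smul_smul] at hv
  exact hv.symm

/-- An eigenvalue `1` with a one-dimensional eigenspace and no Jordan chain of length two is
algebraically simple. -/
theorem finrank_maxGenEigenspace_one {V : Type*} [AddCommGroup V] [Module ℂ V]
    (f : Module.End ℂ V) {v : V} (hv0 : v ≠ 0) (hv : f v = v)
    (hspan : ∀ x, f x = x → ∃ c : ℂ, x + c • v = 0)
    (hchain : ∀ x y, f y = y → f x = x + y → y = 0) :
    Module.finrank ℂ (f.maxGenEigenspace 1) = 1 := by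
  have hker : ∀ (k : ℕ) (x : V), ((f - 1) ^ k) x = 0 → f x = x := by
    intro k
    induction k with
    | zero => intro x hx; simp_all
    | succ k ih =>
      intro x hx
      rw [pow_succ, Module.End.mul_apply] at hx
      have h1 : f x = x + (f - 1) x := by simp
      rw [hchain x _ (ih _ hx) h1, add_zero] at h1
      exact h1
  have hmem : ∀ x, x ∈ f.maxGenEigenspace 1 ↔ f x = x := fun x => by
    rw [Module.End.mem_maxGenEigenspace, one_smul]
    exact ⟨fun ⟨k, hk⟩ => hker k x hk, fun hx => ⟨1, by simp [hx]⟩⟩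
  refine (finrank_eq_one_iff_of_nonzero' (K := ℂ) (V := f.maxGenEigenspace 1)
    ⟨v, (hmem v).2 hv⟩ (fun h => hv0 (congrArg Subtype.val h))).2 ?_
  rintro ⟨x, hx⟩
  obtain ⟨c, hc⟩ := hspan x ((hmem x).1 hx)
  refine ⟨-c, Subtype.ext ?_⟩
  change -c • v = x
  rw [neg_smul, neg_eq_of_add_eq_zero_left hc]

/-! ### The fundamental matrix and variation of constants -/

namespace ControlledOrbit

variable {n : ℕ} (O : ControlledOrbit n)

theorem existsUnique_adjoint (v : Fin n → ℝ) :
    ∃! y : C(Icc 0 O.T, Fin n → ℝ), IsSolution O.T_pos.le (fun t x => -((O.A t)ᵀ *ᵥ x)) v y := by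
  obtain ⟨C, hC⟩ := exists_bound (fun t => ∑ i, ∑ j, ‖(O.A t)ᵀ i j‖)
    (continuous_finsetSum _ fun i _ => continuous_finsetSum _ fun j _ =>
      (O.continuous_A j i).norm) 0 O.T
  refine existsUnique_isSolution _ _ C (fun t ht x y => ?_) (fun x hx => ?_) v
  · rw [neg_sub_neg, ← Matrix.mulVec_sub, norm_sub_rev]
    exact (norm_mulVec_le _ _).trans (by
      rw [norm_sub_rev]; exact mul_le_mul_of_nonneg_right (hC t ht) (norm_nonneg _))
  · exact (Continuous.matrix_mulVec (continuous_matrix fun i j => O.continuous_A j i)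
      hx).neg.intervalIntegrable _ _

/-- The fundamental matrix `Φ(t)` of `y' = A(t) y` on `[0, T]`, with `Φ(0) = 1`; outside `[0, T]`
it is extended by its values at the endpoints. -/
noncomputable def fundamental (t : ℝ) : Matrix (Fin n) (Fin n) ℝ :=
  Matrix.of fun i j => IccExtend O.T_pos.le (O.openLoopSolution (Pi.single j 1)) t i

/-- The inverse `Ψ(t)` of the fundamental matrix, constructed as the solution of `Ψ' = -Ψ A(t)`,
`Ψ(0) = 1`, row by row; outside `[0, T]` it is extended by its values at the endpoints. -/
noncomputable def fundamentalInv (t : ℝ) : Matrix (Fin n) (Fin n) ℝ :=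
  Matrix.of fun i => IccExtend O.T_pos.le (O.existsUnique_adjoint (Pi.single i 1)).choose t

theorem continuous_fundamental : Continuous O.fundamental :=
  continuous_matrix fun i j => (continuous_apply i).comp
    (O.openLoopSolution (Pi.single j 1)).continuous.Icc_extend'

theorem continuous_fundamentalInv : Continuous O.fundamentalInv :=
  continuous_matrix fun i j => (continuous_apply j).comp
    (O.existsUnique_adjoint (Pi.single i 1)).choose.continuous.Icc_extend'

theorem fundamental_T : O.fundamental O.T = O.P₀ := by
  ext i j
  simp only [fundamental, P₀, Matrix.of_apply]
  rw [IccExtend_of_mem _ _ (right_mem_Icc.2 O.T_pos.le)]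

theorem fundamental_zero : O.fundamental 0 = 1 := by
  ext i j
  simp only [fundamental, Matrix.of_apply]
  rw [IccExtend_of_mem _ _ (left_mem_Icc.2 O.T_pos.le), openLoopSolution,
    (O.existsUnique_openLoop (Pi.single j 1)).choose_spec.1]
  simp [Matrix.one_apply, Pi.single_apply]

theorem fundamentalInv_zero : O.fundamentalInv 0 = 1 := by
  ext i j
  simp only [fundamentalInv, Matrix.of_apply]
  rw [IccExtend_of_mem _ _ (left_mem_Icc.2 O.T_pos.le),
    (O.existsUnique_adjoint (Pi.single i 1)).choose_spec.1]
  simp [Matrix.one_apply, Pi.single_apply, eq_comm]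

theorem hasDerivWithinAt_fundamental (i j : Fin n) {t : ℝ} (ht : t ∈ Icc 0 O.T) :
    HasDerivWithinAt (fun t => O.fundamental t i j) ((O.A t * O.fundamental t) i j)
      (Icc 0 O.T) t := by
  have h := (O.existsUnique_openLoop (Pi.single j 1)).choose_spec.1.hasDerivWithinAt
    (Continuous.matrix_mulVec (continuous_matrix fun i j => O.continuous_A i j)
      (O.openLoopSolution (Pi.single j 1)).continuous.Icc_extend') ht
  exact (hasDerivWithinAt_pi.1 h) i

theorem hasDerivWithinAt_fundamentalInv (i j : Fin n) {t : ℝ} (ht : t ∈ Icc 0 O.T) :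
    HasDerivWithinAt (fun t => O.fundamentalInv t i j) (-(O.fundamentalInv t * O.A t) i j)
      (Icc 0 O.T) t := by
  have h := (O.existsUnique_adjoint (Pi.single i 1)).choose_spec.1.hasDerivWithinAt
    (Continuous.matrix_mulVec (continuous_matrix fun i j => O.continuous_A j i)
      (O.existsUnique_adjoint (Pi.single i 1)).choose.continuous.Icc_extend').neg ht
  refine ((hasDerivWithinAt_pi.1 h) j).congr_deriv ?_
  rw [Matrix.mulVec_transpose]
  rfl

theorem fundamentalInv_mul_fundamental {t : ℝ} (ht : t ∈ Icc 0 O.T) :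
    O.fundamentalInv t * O.fundamental t = 1 := by
  ext i j
  have h : ∀ t ∈ Icc 0 O.T, HasDerivWithinAt
      (fun t => (O.fundamentalInv t * O.fundamental t) i j) 0 (Icc 0 O.T) t := fun t ht => by
    have h1 := HasDerivWithinAt.fun_sum (u := Finset.univ) fun k _ =>
      (O.hasDerivWithinAt_fundamentalInv i k ht).mul (O.hasDerivWithinAt_fundamental k j ht)
    refine h1.congr_deriv ?_
    rw [Finset.sum_add_distrib]
    simp only [neg_mul, Finset.sum_neg_distrib]
    change -((O.fundamentalInv t * O.A t) * O.fundamental t) i j +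
      (O.fundamentalInv t * (O.A t * O.fundamental t)) i j = 0
    rw [mul_assoc, neg_add_cancel]
  rw [eq_left_of_hasDerivWithinAt_zero h t ht, O.fundamental_zero, O.fundamentalInv_zero, mul_one]

theorem impulse_of_mem_Icc {δ t : ℝ} (hδ : δ < O.T) (ht : t ∈ Icc 0 δ) :
    O.impulse δ t = 1 / δ := by
  unfold impulse
  rw [if_pos]
  rwa [(toIcoMod_eq_self O.T_pos).2 ⟨ht.1, by linarith [ht.2]⟩]

theorem impulse_of_mem_Ioo {δ t : ℝ} (hδ : 0 < δ) (ht : t ∈ Ioo δ O.T) : O.impulse δ t = 0 := by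
  unfold impulse
  rw [if_neg]
  rw [(toIcoMod_eq_self O.T_pos).2 ⟨(hδ.trans ht.1).le, by linarith [ht.2]⟩]
  exact fun h => (h.2.trans_lt ht.1).false

/-- If `y' = A y + g`, then `(Ψ y)' = Ψ g`. -/
theorem hasDerivWithinAt_fundamentalInv_mulVec {y : ℝ → Fin n → ℂ} {g : Fin n → ℂ} {t : ℝ}
    {S : Set ℝ} (hS : S ⊆ Icc 0 O.T) (ht : t ∈ S)
    (hy : HasDerivWithinAt y ((O.A t).map Complex.ofReal *ᵥ y t + g) S t) :
    HasDerivWithinAt (fun t => (O.fundamentalInv t).map Complex.ofReal *ᵥ y t)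
      ((O.fundamentalInv t).map Complex.ofReal *ᵥ g) S t := by
  refine hasDerivWithinAt_pi.2 fun i => ?_
  have h1 := HasDerivWithinAt.fun_sum (u := Finset.univ) fun k _ =>
    (((O.hasDerivWithinAt_fundamentalInv i k (hS ht)).mono hS).ofReal_comp).mul
      (hasDerivWithinAt_pi.1 hy k)
  refine h1.congr_deriv ?_
  rw [Finset.sum_add_distrib]
  have h2 : ∑ k, (((-(O.fundamentalInv t * O.A t) i k : ℝ)) : ℂ) * y t k =
      -((O.fundamentalInv t).map Complex.ofReal *ᵥ ((O.A t).map Complex.ofReal *ᵥ y t)) i := by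
    rw [Matrix.mulVec_mulVec]
    simp only [Complex.ofReal_neg, neg_mul, Finset.sum_neg_distrib]
    congr 1
    refine Finset.sum_congr rfl fun k _ => ?_
    congr 1
    simp [Matrix.mul_apply]
  rw [h2]
  change _ + ((O.fundamentalInv t).map Complex.ofReal *ᵥ
    ((O.A t).map Complex.ofReal *ᵥ y t + g)) i = _
  rw [Matrix.mulVec_add, Pi.add_apply, neg_add_cancel_left]

/-- In the coordinates `u = Ψ y` the state moves only during the impulse. -/
theorem variation_of_constants {K₀ : Fin n → ℝ} {δ : ℝ} (hδ : δ ∈ Ioo 0 O.T)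
    {y yt : ℝ → Fin n → ℂ} (hyc : Continuous y) (hytc : Continuous yt)
    (hy : ∀ t ∈ Icc 0 O.T, y t = y 0 + ∫ s in (0 : ℝ)..t, O.linRhs K₀ δ s (y s) (yt s)) :
    ∃ u : ℝ → Fin n → ℂ, u 0 = y 0 ∧
      (∀ t ∈ Icc 0 O.T, y t = (O.fundamental t).map Complex.ofReal *ᵥ u t) ∧
      (∀ t ∈ Icc 0 δ, HasDerivWithinAt u
        ((((1 / δ : ℝ) : ℂ) * ((fun j => (K₀ j : ℂ)) ⬝ᵥ (yt t - y t))) •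
          ((O.fundamentalInv t).map Complex.ofReal *ᵥ fun i => (O.b t i : ℂ))) (Icc 0 δ) t) ∧
      ∀ t ∈ Icc δ O.T, u t = u δ := by
  have hA : Continuous fun t => (O.A t).map Complex.ofReal *ᵥ y t :=
    Continuous.matrix_mulVec (continuous_matrix fun i j =>
      Complex.continuous_ofReal.comp (O.continuous_A i j)) hyc
  have hb : Continuous fun t i => (O.b t i : ℂ) := continuous_pi fun i =>
    Complex.continuous_ofReal.comp ((continuous_apply i).comp O.continuous_b)
  have hK : Continuous fun t => (fun j => (K₀ j : ℂ)) ⬝ᵥ (yt t - y t) :=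
    Continuous.dotProduct continuous_const (hytc.sub hyc)
  have hint : ∀ a b, IntervalIntegrable (fun s => O.linRhs K₀ δ s (y s) (yt s)) volume a b := by
    intro a b
    have h := O.intervalIntegrable_linRhs K₀ δ (a - O.T) (b - O.T)
      (hyc.comp (continuous_add_const O.T)) (hytc.comp (continuous_add_const O.T))
    simpa using h.comp_sub_right O.T
  refine ⟨fun t => (O.fundamentalInv t).map Complex.ofReal *ᵥ y t, ?_, fun t ht => ?_,
    fun t ht => ?_, ?_⟩
  · simp [O.fundamentalInv_zero]
  · rw [Matrix.mulVec_mulVec]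
    have h1 : O.fundamental t * O.fundamentalInv t = 1 :=
      mul_eq_one_comm.1 (O.fundamentalInv_mul_fundamental ht)
    have h2 : (O.fundamental t).map Complex.ofReal * (O.fundamentalInv t).map Complex.ofReal =
        (O.fundamental t * O.fundamentalInv t).map Complex.ofReal :=
      (Matrix.map_mul (f := Complex.ofRealHom)).symm
    rw [h2, h1]
    simp
  · rw [← Matrix.mulVec_smul]
    refine O.hasDerivWithinAt_fundamentalInv_mulVec (Icc_subset_Icc_right hδ.2.le) ht ?_
    refine hasDerivWithinAt_of_eq_integral (hA.add ((continuous_const.mul hK).smul hb))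
      (fun s hs => ?_) (fun t ht => hy t ⟨ht.1, ht.2.trans hδ.2.le⟩) ht
    simp only [linRhs]
    rw [O.impulse_of_mem_Icc hδ.2 (Ioo_subset_Icc_self hs)]
    rfl
  · refine eq_left_of_hasDerivWithinAt_zero fun t ht => ?_
    have h := O.hasDerivWithinAt_fundamentalInv_mulVec (y := y) (g := 0)
      (Icc_subset_Icc_left hδ.1.le) ht (by
        rw [add_zero]
        refine hasDerivWithinAt_of_eq_integral hA (g := fun s => O.linRhs K₀ δ s (y s) (yt s))
          (fun s hs => ?_) (fun t ht => ?_) ht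
        · simp only [linRhs]
          rw [O.impulse_of_mem_Ioo hδ.1 hs]
          simp
        · rw [hy t ⟨hδ.1.le.trans ht.1, ht.2⟩, hy δ (Ioo_subset_Icc_self hδ), add_assoc,
            intervalIntegral.integral_add_adjacent_intervals (hint _ _) (hint _ _)])
    simpa using h

/-! ### The time-`T` map as an impulse -/

/-- The direction `β(t) = Ψ(t) b(t)` in which the feedback acts, in the coordinates `u = Ψ x`. -/
noncomputable def pulseInput (t : ℝ) : Fin n → ℂ :=
  (O.fundamentalInv t).map Complex.ofReal *ᵥ fun i => (O.b t i : ℂ)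

/-- The measured functional `K₀ᵀ Φ(t)` in the coordinates `u = Ψ x`. -/
noncomputable def pulseOutput (K₀ : Fin n → ℝ) (t : ℝ) : Fin n → ℂ :=
  (fun j => (K₀ j : ℂ)) ᵥ* (O.fundamental t).map Complex.ofReal

theorem continuous_pulseInput : Continuous O.pulseInput :=
  Continuous.matrix_mulVec
    (continuous_matrix fun i j => Complex.continuous_ofReal.comp
      (O.continuous_fundamentalInv.matrix_elem i j))
    (continuous_pi fun i => Complex.continuous_ofReal.comp
      ((continuous_apply i).comp O.continuous_b))

theorem continuous_pulseOutput (K₀ : Fin n → ℝ) : Continuous (O.pulseOutput K₀) :=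
  Continuous.matrix_vecMul continuous_const
    (continuous_matrix fun i j => Complex.continuous_ofReal.comp
      (O.continuous_fundamental.matrix_elem i j))

theorem pulseInput_zero : O.pulseInput 0 = fun i => (O.b 0 i : ℂ) := by
  simp [pulseInput, O.fundamentalInv_zero]

theorem pulseOutput_zero (K₀ : Fin n → ℝ) : O.pulseOutput K₀ 0 = fun j => (K₀ j : ℂ) := by
  simp [pulseOutput, O.fundamental_zero]

theorem linRhs_self (K₀ : Fin n → ℝ) (δ t : ℝ) (x : Fin n → ℂ) :
    O.linRhs K₀ δ t x x = (O.A t).map Complex.ofReal *ᵥ x := by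
  simp [linRhs]

variable {O}

/-- The time-`T` map reduced to the impulse, with time rescaled to `τ = t / δ ∈ [0, 1]`. -/
theorem IsTimeTImage.exists_pulse {K₀ : Fin n → ℝ} {ε δ : ℝ} (hδ : δ ∈ Ioo 0 O.T)
    {φ ψ : O.History × O.History} (h : O.IsTimeTImage K₀ ε δ φ ψ) :
    ∃ U : ℝ → Fin n → ℂ, U 0 = φ.1 O.final ∧
      ψ.1 O.final = O.P₀.map Complex.ofReal *ᵥ U 1 ∧
      (∀ τ ∈ Icc (0 : ℝ) 1, IccExtend O.neg_T_le ψ.1 (δ * τ - O.T) =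
        (O.fundamental (δ * τ)).map Complex.ofReal *ᵥ U τ) ∧
      (∀ τ ∈ Icc (0 : ℝ) 1, HasDerivWithinAt U
        (((fun j => (K₀ j : ℂ)) ⬝ᵥ (IccExtend O.neg_T_le ψ.2 (δ * τ - O.T) -
          IccExtend O.neg_T_le ψ.1 (δ * τ - O.T))) • O.pulseInput (δ * τ)) (Icc 0 1) τ) ∧
      ((∀ τ ∈ Icc (0 : ℝ) 1, U τ = 0) → ψ.1 = 0) := by
  have hsh : Continuous fun t : ℝ => t - O.T := by fun_prop
  have hTm : ∀ t ∈ Icc 0 O.T, t - O.T ∈ Icc (-O.T) 0 := fun t ht =>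
    ⟨by linarith [ht.1], by linarith [ht.2]⟩
  have hy0 : IccExtend O.neg_T_le ψ.1 (0 - O.T) = φ.1 O.final := by
    rw [IccExtend_of_mem _ _ (hTm 0 ⟨le_rfl, O.T_pos.le⟩), h.fst_eq]
    simp
  obtain ⟨u, hu0, hyu, hu', huc⟩ := O.variation_of_constants (K₀ := K₀) hδ
    (y := fun t => IccExtend O.neg_T_le ψ.1 (t - O.T))
    (yt := fun t => IccExtend O.neg_T_le ψ.2 (t - O.T))
    (ψ.1.continuous.Icc_extend'.comp hsh) (ψ.2.continuous.Icc_extend'.comp hsh)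
    (fun t ht => by
      have h1 := intervalIntegral.integral_comp_sub_right (a := 0) (b := t)
        (fun s => O.linRhs K₀ δ (s + O.T) (IccExtend O.neg_T_le ψ.1 s)
          (IccExtend O.neg_T_le ψ.2 s)) O.T
      simp only [sub_add_cancel] at h1
      simp only [hy0]
      rw [h1, IccExtend_of_mem _ _ (hTm t ht), h.fst_eq, zero_sub])
  have hmaps : MapsTo (fun τ : ℝ => δ * τ) (Icc 0 1) (Icc 0 δ) := fun τ hτ =>
    ⟨mul_nonneg hδ.1.le hτ.1, mul_le_of_le_one_right hδ.1.le hτ.2⟩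
  refine ⟨fun τ => u (δ * τ), ?_, ?_, fun τ hτ => ?_, fun τ hτ => ?_, fun h0 => ?_⟩
  · simp only [mul_zero]
    exact hu0.trans hy0
  · have h1 := hyu O.T ⟨O.T_pos.le, le_rfl⟩
    simp only [sub_self] at h1
    rw [O.fundamental_T, huc O.T ⟨hδ.2.le, le_rfl⟩,
      IccExtend_of_mem _ _ (right_mem_Icc.2 O.neg_T_le)] at h1
    simp only [mul_one]
    exact h1
  · exact hyu _ (Icc_subset_Icc_right hδ.2.le (hmaps hτ))
  · have h1 := (hu' _ (hmaps hτ)).scomp τ (by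
      simpa using ((hasDerivAt_id τ).const_mul δ).hasDerivWithinAt) hmaps
    refine h1.congr_deriv ?_
    have hδ0 : (δ : ℂ) ≠ 0 := by exact_mod_cast hδ.1.ne'
    rw [← Complex.coe_smul, smul_smul, pulseInput]
    congr 1
    push_cast
    field_simp
  · refine ContinuousMap.ext fun s => ?_
    have hs : (s : ℝ) + O.T ∈ Icc 0 O.T := ⟨by linarith [s.2.1], by linarith [s.2.2]⟩
    have h1 := hyu _ hs
    have hu : u (s + O.T) = 0 := by
      have hδz : ∀ t ∈ Icc 0 δ, u t = 0 := fun t ht => by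
        have := h0 (t / δ) ⟨div_nonneg ht.1 hδ.1.le, (div_le_one hδ.1).2 ht.2⟩
        simpa only [mul_div_cancel₀ _ hδ.1.ne'] using this
      rcases le_total ((s : ℝ) + O.T) δ with hle | hle
      · exact hδz _ ⟨hs.1, hle⟩
      · rw [huc _ ⟨hle, hs.2⟩]
        exact hδz _ ⟨hδ.1.le, le_rfl⟩
    simpa [hu] using h1

/-- The reduction for an eigenvector, where `φ.2 = ε / (lam - 1 + ε) φ.1` turns the feedback term
into `-κ K₀ᵀ x` with `κ = (lam - 1) / (lam - 1 + ε)`. -/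
theorem IsTimeTImage.exists_pulse_of_smul {K₀ : Fin n → ℝ} {ε δ : ℝ} (hδ : δ ∈ Ioo 0 O.T)
    {lam : ℂ} (hlam : lam ≠ 0) (hne : lam - 1 + ε ≠ 0) {φ : O.History × O.History}
    (h : O.IsTimeTImage K₀ ε δ φ (lam • φ)) :
    ∃ U : ℝ → Fin n → ℂ, U 0 = φ.1 O.final ∧
      lam • φ.1 O.final = O.P₀.map Complex.ofReal *ᵥ U 1 ∧
      (∀ τ ∈ Icc (0 : ℝ) 1, lam • IccExtend O.neg_T_le φ.1 (δ * τ - O.T) =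
        (O.fundamental (δ * τ)).map Complex.ofReal *ᵥ U τ) ∧
      (∀ τ ∈ Icc (0 : ℝ) 1, HasDerivWithinAt U
        (-((lam - 1) / (lam - 1 + ε) * (O.pulseOutput K₀ (δ * τ) ⬝ᵥ U τ)) •
          O.pulseInput (δ * τ)) (Icc 0 1) τ) ∧
      (φ.1 O.final = 0 → φ = 0) := by
  have hsnd : ∀ s, φ.2 s = ((ε : ℂ) / (lam - 1 + ε)) • φ.1 s := fun s => by
    have h1 : lam • φ.2 s = (1 - ε : ℂ) • φ.2 s + (ε : ℂ) • φ.1 s := h.snd_eq s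
    have h2 : (lam - 1 + ε) • φ.2 s = (ε : ℂ) • φ.1 s := by
      have : (lam - 1 + ε) • φ.2 s = lam • φ.2 s - (1 - ε : ℂ) • φ.2 s := by module
      rw [this, h1, add_sub_cancel_left]
    rw [div_eq_inv_mul, mul_smul, ← h2, inv_smul_smul₀ hne]
  obtain ⟨U, hU0, hU1, hUy, hU', hUz⟩ := h.exists_pulse hδ
  have hUd : ∀ τ ∈ Icc (0 : ℝ) 1, HasDerivWithinAt U
      (-((lam - 1) / (lam - 1 + ε) * (O.pulseOutput K₀ (δ * τ) ⬝ᵥ U τ)) •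
        O.pulseInput (δ * τ)) (Icc 0 1) τ := fun τ hτ => by
    refine (hU' τ hτ).congr_deriv ?_
    have h1 : IccExtend O.neg_T_le (lam • φ).2 (δ * τ - O.T) -
        IccExtend O.neg_T_le (lam • φ).1 (δ * τ - O.T) =
        (-((lam - 1) / (lam - 1 + ε))) • IccExtend O.neg_T_le (lam • φ).1 (δ * τ - O.T) := by
      simp only [IccExtend, Function.comp_apply, Prod.smul_snd, Prod.smul_fst,
        ContinuousMap.smul_apply, hsnd]
      rw [smul_smul, smul_smul, ← sub_smul]
      congr 1
      field_simp
      ring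
    rw [h1, hUy τ hτ, dotProduct_smul, Matrix.dotProduct_mulVec, smul_eq_mul, neg_mul, pulseOutput]
  refine ⟨U, hU0, hU1, hUy, hUd, fun hv => ?_⟩
  have hz : ∀ τ ∈ Icc (0 : ℝ) 1, U τ = 0 := by
    obtain ⟨C, hC⟩ := exists_bound (fun τ => ‖(lam - 1) / (lam - 1 + ε)‖ *
      (n * ‖O.pulseOutput K₀ (δ * τ)‖) * ‖O.pulseInput (δ * τ)‖) (by
        have h1 := (O.continuous_pulseOutput K₀).comp (continuous_const_mul δ)
        have h2 := O.continuous_pulseInput.comp (continuous_const_mul δ)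
        exact (continuous_const.mul (continuous_const.mul h1.norm)).mul h2.norm) 0 1
    refine eq_zero_of_abs_deriv_le_mul_abs_self_of_eq_zero_right (K := C)
      (fun τ hτ => (hUd τ hτ).continuousWithinAt)
      (fun τ hτ => hasDerivWithinAt_Ici_of_Icc (hUd τ (Ico_subset_Icc_self hτ)) hτ)
      (by rw [hU0, hv]) fun τ hτ => ?_
    rw [norm_smul, norm_neg, norm_mul]
    have h1 := norm_dotProduct_le (O.pulseOutput K₀ (δ * τ)) (U τ)
    calc _ ≤ ‖(lam - 1) / (lam - 1 + ε)‖ * (n * ‖O.pulseOutput K₀ (δ * τ)‖ * ‖U τ‖) *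
          ‖O.pulseInput (δ * τ)‖ := by gcongr
      _ = (‖(lam - 1) / (lam - 1 + ε)‖ * (n * ‖O.pulseOutput K₀ (δ * τ)‖) *
          ‖O.pulseInput (δ * τ)‖) * ‖U τ‖ := by ring
      _ ≤ _ := mul_le_mul_of_nonneg_right (hC τ (Ico_subset_Icc_self hτ)) (norm_nonneg _)
  have h1 : lam • φ.1 = 0 := hUz hz
  have h2 : φ.1 = 0 := (smul_eq_zero.1 h1).resolve_left hlam
  refine Prod.ext h2 (ContinuousMap.ext fun s => ?_)
  rw [hsnd, h2]
  simp

/-- For the multiplier `1` the feedback vanishes, and the eigenvectors are the periodic solutions of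
the uncontrolled equation. -/
theorem IsTimeTImage.exists_pulse_of_fixed {K₀ : Fin n → ℝ} {ε δ : ℝ} (hδ : δ ∈ Ioo 0 O.T)
    (hε : ε ≠ 0) {χ : O.History × O.History} (h : O.IsTimeTImage K₀ ε δ χ χ) :
    O.P₀.map Complex.ofReal *ᵥ χ.1 O.final = χ.1 O.final ∧
      (∀ τ ∈ Icc (0 : ℝ) 1, IccExtend O.neg_T_le χ.1 (δ * τ - O.T) =
        (O.fundamental (δ * τ)).map Complex.ofReal *ᵥ χ.1 O.final) ∧
      (∀ s, χ.2 s = χ.1 s) ∧ (χ.1 O.final = 0 → χ = 0) := by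
  have hεc : (ε : ℂ) ≠ 0 := by exact_mod_cast hε
  obtain ⟨U, hU0, hU1, hUy, hU', hUz⟩ := IsTimeTImage.exists_pulse_of_smul hδ one_ne_zero
    (by simpa using hεc) (show O.IsTimeTImage K₀ ε δ χ ((1 : ℂ) • χ) by rwa [one_smul])
  simp only [sub_self, zero_div, zero_mul, neg_zero, zero_smul] at hU'
  have hc := eq_left_of_hasDerivWithinAt_zero hU'
  refine ⟨?_, fun τ hτ => ?_, fun s => ?_, hUz⟩
  · rw [hc 1 (by simp), hU0, one_smul] at hU1
    exact hU1.symm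
  · have := hUy τ hτ
    rwa [hc τ hτ, hU0, one_smul] at this
  · have h1 := h.snd_eq s
    have h2 : (ε : ℂ) • (χ.2 s - χ.1 s) = 0 := by
      have : (ε : ℂ) • (χ.2 s - χ.1 s) =
        χ.2 s - ((1 - ε : ℂ) • χ.2 s + (ε : ℂ) • χ.1 s) := by module
      rw [this, ← h1, sub_self]
    exact sub_eq_zero.1 ((smul_eq_zero.1 h2).resolve_left hεc)

/-- The reduction for a Jordan chain `φ ↦ φ + χ`, `χ ↦ χ`: the feedback term is `-ε⁻¹ K₀ᵀ χ`, known
in advance. -/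
theorem IsTimeTImage.exists_pulse_of_add {K₀ : Fin n → ℝ} {ε δ : ℝ} (hδ : δ ∈ Ioo 0 O.T)
    (hε : ε ≠ 0) {χ φ : O.History × O.History} (h : O.IsTimeTImage K₀ ε δ χ χ)
    (h' : O.IsTimeTImage K₀ ε δ φ (φ + χ)) :
    ∃ U : ℝ → Fin n → ℂ, U 0 = φ.1 O.final ∧
      φ.1 O.final + χ.1 O.final = O.P₀.map Complex.ofReal *ᵥ U 1 ∧
      (∀ τ ∈ Icc (0 : ℝ) 1, HasDerivWithinAt U
        (-((ε : ℂ)⁻¹ * (O.pulseOutput K₀ (δ * τ) ⬝ᵥ χ.1 O.final)) •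
          O.pulseInput (δ * τ)) (Icc 0 1) τ) := by
  have hεc : (ε : ℂ) ≠ 0 := by exact_mod_cast hε
  obtain ⟨-, hχy, hχ2, -⟩ := h.exists_pulse_of_fixed hδ hε
  obtain ⟨U, hU0, hU1, hUy, hU', -⟩ := h'.exists_pulse hδ
  refine ⟨U, hU0, hU1, fun τ hτ => (hU' τ hτ).congr_deriv ?_⟩
  have hs : ∀ s, (φ + χ).2 s - (φ + χ).1 s = (-(ε : ℂ)⁻¹) • χ.1 s := fun s => by
    have h1 : φ.2 s + χ.2 s = (1 - ε : ℂ) • φ.2 s + (ε : ℂ) • φ.1 s := h'.snd_eq s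
    rw [hχ2] at h1
    have h2 : (ε : ℂ) • (φ.2 s - φ.1 s) = -χ.1 s := by
      have : (ε : ℂ) • (φ.2 s - φ.1 s) = (φ.2 s + χ.1 s) -
        ((1 - ε : ℂ) • φ.2 s + (ε : ℂ) • φ.1 s) - χ.1 s := by module
      rw [this, h1, sub_self, zero_sub]
    simp only [Prod.snd_add, Prod.fst_add, ContinuousMap.add_apply, hχ2]
    rw [add_sub_add_right_eq_sub, neg_smul, ← smul_neg, ← h2, inv_smul_smul₀ hεc]
  have h1 : IccExtend O.neg_T_le (φ + χ).2 (δ * τ - O.T) -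
      IccExtend O.neg_T_le (φ + χ).1 (δ * τ - O.T) =
      (-(ε : ℂ)⁻¹) • IccExtend O.neg_T_le χ.1 (δ * τ - O.T) := hs _
  rw [h1, hχy τ hτ, dotProduct_smul, Matrix.dotProduct_mulVec, smul_eq_mul, neg_mul, pulseOutput]

/-! ### The velocity of the orbit -/

variable (O)

/-- The velocity `f(x_*, 0)` of the periodic orbit solves the variational equation. -/
theorem hasDerivAt_tangent (t : ℝ) :
    HasDerivAt (fun t => O.f (O.xs t, 0)) (O.A t *ᵥ O.f (O.xs t, 0)) t := by
  have hd : HasFDerivAt O.f (fderiv ℝ O.f (O.xs t, 0)) (O.xs t, 0) :=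
    (O.smooth.differentiable (by simp) _).hasFDerivAt
  have h := hd.comp_hasDerivAt t ((O.solves t).prodMk (hasDerivAt_const t (0 : ℝ)))
  refine h.congr_deriv ?_
  set v := O.f (O.xs t, 0)
  have hsplit : (v, (0 : ℝ)) = ∑ j, v j • ((Pi.single j 1 : Fin n → ℝ), (0 : ℝ)) := by
    refine Prod.ext ?_ ?_
    · ext i
      simp [Prod.fst_sum, Finset.sum_apply, Pi.single_apply]
    · simp [Prod.snd_sum]
  rw [hsplit, map_sum]
  ext i
  simp only [map_smul, Matrix.mulVec, dotProduct, A, Finset.sum_apply, Pi.smul_apply, smul_eq_mul,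
    Matrix.of_apply]
  exact Finset.sum_congr rfl fun j _ => mul_comm _ _

/-- The velocity `x_*'` of the periodic orbit on `[-T, 0]`, as a complex history. -/
noncomputable def tangent : O.History where
  toFun s i := (O.f (O.xs s, 0) i : ℂ)
  continuous_toFun := by
    have h : Continuous fun t => O.f (O.xs t, 0) :=
      continuous_iff_continuousAt.2 fun t => (O.hasDerivAt_tangent t).continuousAt
    exact continuous_pi fun i => Complex.continuous_ofReal.comp
      ((continuous_apply i).comp (h.comp continuous_subtype_val))

theorem tangent_ne_zero : O.tangent ≠ 0 := by
  intro h
  have h0 : ∀ s ∈ Icc (-O.T) 0, O.f (O.xs s, 0) = 0 := fun s hs => by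
    have h1 := DFunLike.congr_fun h ⟨s, hs⟩
    ext i
    exact Complex.ofReal_eq_zero.1 (congrFun h1 i)
  have hper : Function.Periodic (fun t => O.f (O.xs t, 0)) O.T := fun t => by
    simp only [O.periodic t]
  have hall : ∀ t, O.f (O.xs t, 0) = 0 := fun t => by
    obtain ⟨s, hs, hst⟩ := hper.exists_mem_Ico O.T_pos t (-O.T)
    exact hst.trans (h0 s ⟨hs.1, by linarith [hs.2]⟩)
  obtain ⟨t, ht⟩ := O.nonconstant
  refine ht (is_const_of_deriv_eq_zero (fun t => (O.solves t).differentiableAt) (fun t => ?_) t 0)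
  rw [(O.solves t).deriv, hall]

theorem isTimeTImage_tangent (K₀ : Fin n → ℝ) (ε δ : ℝ) :
    O.IsTimeTImage K₀ ε δ (O.tangent, O.tangent) (O.tangent, O.tangent) := by
  refine ⟨fun s => by module, fun t => ?_⟩
  simp only [linRhs_self]
  have hd : ∀ s, HasDerivAt (fun s i => (O.f (O.xs s, 0) i : ℂ))
      ((O.A s).map Complex.ofReal *ᵥ fun i => (O.f (O.xs s, 0) i : ℂ)) s := fun s =>
    hasDerivAt_pi.2 fun i => ((hasDerivAt_pi.1 (O.hasDerivAt_tangent s) i).ofReal_comp).congr_deriv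
      (by simp [Matrix.mulVec, dotProduct])
  have hc : Continuous fun s => (O.A s).map Complex.ofReal *ᵥ
      fun i => (O.f (O.xs s, 0) i : ℂ) :=
    Continuous.matrix_mulVec (continuous_matrix fun i j =>
      Complex.continuous_ofReal.comp (O.continuous_A i j))
      (continuous_iff_continuousAt.2 fun s => (hd s).continuousAt)
  have hfin : O.tangent O.final = O.tangent O.start := by
    have := O.periodic (-O.T)
    rw [neg_add_cancel] at this
    ext i
    simp [tangent, final, start, this]
  have hA : ∀ s, O.A (s + O.T) = O.A s := fun s => by
    simp only [A, O.periodic s]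
  have hcongr : ∫ s in -O.T..(t : ℝ), (O.A (s + O.T)).map Complex.ofReal *ᵥ
        IccExtend O.neg_T_le O.tangent s =
      ∫ s in -O.T..(t : ℝ), (O.A s).map Complex.ofReal *ᵥ fun i => (O.f (O.xs s, 0) i : ℂ) := by
    refine intervalIntegral.integral_congr fun s hs => ?_
    rw [uIcc_of_le t.2.1] at hs
    simp only [hA]
    rw [IccExtend_of_mem _ _ ⟨hs.1, hs.2.trans t.2.2⟩]
    rfl
  rw [hcongr, intervalIntegral.integral_eq_sub_of_hasDerivAt (fun s _ => hd s)
    (hc.intervalIntegrable _ _), hfin]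
  exact (add_sub_cancel _ _).symm

theorem isTimeTImage_timeTMap (K₀ : Fin n → ℝ) (ε δ : ℝ) (φ : O.phaseSpace ε) :
    O.IsTimeTImage K₀ ε δ φ (O.timeTMap K₀ ε δ φ) :=
  (O.existsUnique_isTimeTImage K₀ ε δ φ).choose_spec.1

/-! ### Multipliers for small parameters -/

/-- For small `ε` and `δ` there are no eigenvectors for multipliers `lam ≠ 1` outside the open unit
disc, and no Jordan chains of length two for the multiplier `1`. Both reduce to
`eq_zero_of_approx_multiplier`, the second with `lam = 1` and `κ = 0`. -/
theorem exists_no_outer_multiplier_no_jordanChain {K₀ : Fin n → ℝ}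
    (hH : ∀ (lam : ℂ) (v : Fin n → ℂ), 1 ≤ ‖lam‖ → lam • v = O.P₀.map Complex.ofReal *ᵥ
      (v - (dslope Complex.exp 0 (-((K₀ ⬝ᵥ O.b 0 : ℝ) : ℂ)) * ((fun j => (K₀ j : ℂ)) ⬝ᵥ v)) •
        fun i => (O.b 0 i : ℂ)) → v = 0) :
    ∃ εmax ∈ Ioo (0 : ℝ) 1, ∃ δmax ∈ Ioo (0 : ℝ) O.T, ∀ ε ∈ Ioo 0 εmax, ∀ δ ∈ Ioo 0 δmax,
      (∀ (lam : ℂ) (φ : O.History × O.History), 1 ≤ ‖lam‖ → lam ≠ 1 →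
        O.IsTimeTImage K₀ ε δ φ (lam • φ) → φ = 0) ∧
      ∀ φ χ : O.History × O.History, O.IsTimeTImage K₀ ε δ χ χ →
        O.IsTimeTImage K₀ ε δ φ (φ + χ) → χ = 0 := by
  have hT := O.T_pos
  set s : ℝ := K₀ ⬝ᵥ O.b 0 with hs
  set K : Fin n → ℂ := fun j => (K₀ j : ℂ) with hK
  set b : Fin n → ℂ := fun i => (O.b 0 i : ℂ) with hb
  set P : Matrix (Fin n) (Fin n) ℂ := O.P₀.map Complex.ofReal
  have hKb : K ⬝ᵥ b = s := by simp [hK, hb, hs, dotProduct]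
  have hT2 : O.T / 2 ∈ Ioo 0 O.T := ⟨by linarith, by linarith⟩
  -- The fixed-vector relation does not involve `ε` and `δ`, so any admissible values will do here.
  obtain ⟨hPv₀, -, -, hz₀⟩ :=
    (O.isTimeTImage_tangent K₀ 1 (O.T / 2)).exists_pulse_of_fixed hT2 one_ne_zero
  have hv₀ : O.tangent O.final ≠ 0 := fun h => O.tangent_ne_zero (congrArg Prod.fst (hz₀ h))
  obtain ⟨w, hwP, hwb⟩ := exists_left_fixed (dslope Complex.exp 0 (-(s : ℂ)))
    (fun v hv => hH 1 v (by simp) (by rwa [one_smul])) hv₀ hPv₀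
  obtain ⟨ε₀, hε₀, η, hη, hcore⟩ := eq_zero_of_approx_multiplier P b K w s hH hwb
  obtain ⟨δ₁, hδ₁, hpulse⟩ := exists_approx_impulse O.continuous_pulseInput
    (O.continuous_pulseOutput K₀) s (by rw [pulseInput_zero, pulseOutput_zero]; exact hKb) hη
  obtain ⟨δ₂, hδ₂, hforce⟩ := exists_approx_forcing O.continuous_pulseInput
    (O.continuous_pulseOutput K₀) hη
  rw [pulseInput_zero, pulseOutput_zero] at hpulse hforce
  have hwPv : ∀ x, w ⬝ᵥ (P *ᵥ x) = w ⬝ᵥ x := fun x => by rw [Matrix.dotProduct_mulVec, hwP]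
  refine ⟨min ε₀ (1 / 2), ⟨by positivity, (min_le_right _ _).trans_lt (by norm_num)⟩,
    min (min δ₁ δ₂) (O.T / 2), ⟨by positivity, (min_le_right _ _).trans_lt hT2.2⟩,
    fun ε hε δ hδ => ?_⟩
  have hε0 := hε.1
  have hεε : ε < ε₀ := hε.2.trans_le (min_le_left _ _)
  have hε1 : ε < 1 := hε.2.trans_le ((min_le_right _ _).trans (by norm_num))
  have hδδ₁ : δ < δ₁ := hδ.2.trans_le ((min_le_left _ _).trans (min_le_left _ _))
  have hδδ₂ : δ < δ₂ := hδ.2.trans_le ((min_le_left _ _).trans (min_le_right _ _))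
  have hδT : δ ∈ Ioo 0 O.T := ⟨hδ.1, hδ.2.trans ((min_le_right _ _).trans_lt hT2.2)⟩
  have hεc : (ε : ℂ) ≠ 0 := by exact_mod_cast hε0.ne'
  constructor
  · intro lam φ hlam hlam1 h
    obtain ⟨hne, hκ⟩ := norm_feedbackFactor_sub_one_le hε0 hε1 hlam
    obtain ⟨U, hU0, hU1, -, hU', hz⟩ := h.exists_pulse_of_smul hδT
      (norm_pos_iff.1 (one_pos.trans_le hlam)) hne
    set κ := (lam - 1) / (lam - 1 + ε)
    have hκ2 : ‖κ‖ ≤ 2 := by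
      have := norm_add_le (κ - 1) 1
      rw [sub_add_cancel, norm_one] at this
      linarith
    have hκ0 : κ ≠ 0 := div_ne_zero (sub_ne_zero.2 hlam1) hne
    have happ := hpulse δ hδ.1 hδδ₁ κ hκ2 U hU'
    set v := φ.1 O.final with hv
    rw [hU0] at happ
    -- The kick `q` is recovered from `U 1 = v - κ q`, as `lam ≠ 1` makes `κ` nonzero.
    have hUq : U 1 = v - κ • (κ⁻¹ • (v - U 1)) := by
      rw [smul_inv_smul₀ hκ0, sub_sub_cancel]
    have hev : lam • v = P *ᵥ (v - κ • (κ⁻¹ • (v - U 1))) := by rw [← hUq]; exact hU1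
    refine hz (hcore ε hε0 hεε lam v (κ⁻¹ • (v - U 1)) hlam hev ?_ ?_)
    · have h1 := congrArg (w ⬝ᵥ ·) hev
      simp only [hwPv, dotProduct_sub, dotProduct_smul, smul_eq_mul] at h1 ⊢
      have h2 : κ * (lam - 1 + ε) = lam - 1 := div_mul_cancel₀ _ hne
      refine mul_left_cancel₀ hκ0 ?_
      linear_combination h1 + (w ⬝ᵥ v) * h2
    · have h1 : κ⁻¹ • (v - U 1) - (dslope Complex.exp 0 (-(κ * s)) * (K ⬝ᵥ v)) • b =
          (-κ⁻¹) • (U 1 - (v - (κ * (dslope Complex.exp 0 (-(κ * s)) * (K ⬝ᵥ v))) • b)) := by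
        rw [mul_smul κ, smul_sub (-κ⁻¹), smul_sub (-κ⁻¹), neg_smul κ⁻¹ (κ • _),
          inv_smul_smul₀ hκ0]
        module
      rw [h1, norm_smul, norm_neg, norm_inv]
      calc ‖κ‖⁻¹ * _ ≤ ‖κ‖⁻¹ * (η * ‖κ‖ * ‖v‖) :=
            mul_le_mul_of_nonneg_left happ (by positivity)
        _ = η * ‖v‖ := by
            have : ‖κ‖ ≠ 0 := norm_ne_zero_iff.2 hκ0
            field_simp
  · intro φ χ hχ hφ
    obtain ⟨hPv, -, -, hz⟩ := hχ.exists_pulse_of_fixed hδT hε0.ne'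
    obtain ⟨U, hU0, hU1, hU'⟩ := hχ.exists_pulse_of_add hδT hε0.ne' hφ
    have happ := hforce δ hδ.1 hδδ₂ (ε : ℂ)⁻¹ _ U hU'
    set v := χ.1 O.final with hv
    rw [hU0] at happ
    set x := φ.1 O.final
    -- Here `U 1 = x - ε⁻¹ q`.
    refine hz (hcore ε hε0 hεε 1 v ((ε : ℂ) • (x - U 1)) (by simp) ?_ ?_ ?_)
    · rw [sub_self, zero_div, zero_smul, sub_zero, one_smul]
      exact hPv.symm
    · have h1 := congrArg (w ⬝ᵥ ·) hU1
      have h2 : w ⬝ᵥ (P *ᵥ U 1) = w ⬝ᵥ U 1 := hwPv _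
      simp only [dotProduct_add, dotProduct_sub, dotProduct_smul, smul_eq_mul] at h1 ⊢
      rw [h2] at h1
      linear_combination ε * h1
    · have h1 : (ε : ℂ) • (x - U 1) - (dslope Complex.exp 0 (-((1 - 1) / (1 - 1 + (ε : ℂ)) * s)) *
          (K ⬝ᵥ v)) • b = (-ε : ℂ) • (U 1 - (x - ((ε : ℂ)⁻¹ * (K ⬝ᵥ v)) • b)) := by
        rw [sub_self, zero_div, zero_mul, neg_zero, dslope_exp_zero, one_mul, mul_smul,
          smul_sub (-ε : ℂ), smul_sub (-ε : ℂ), neg_smul (ε : ℂ) ((ε : ℂ)⁻¹ • _),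
          smul_inv_smul₀ hεc]
        module
      rw [h1, norm_smul, norm_neg]
      calc ‖(ε : ℂ)‖ * _ ≤ ‖(ε : ℂ)‖ * (η * ‖(ε : ℂ)⁻¹‖ * ‖v‖) :=
            mul_le_mul_of_nonneg_left happ (norm_nonneg _)
        _ = η * ‖v‖ := by
            have : ‖(ε : ℂ)‖ ≠ 0 := norm_ne_zero_iff.2 hεc
            rw [norm_inv]
            field_simp

/-- The multiplier `1` belongs to the velocity of the orbit. The functional `v ↦ K₀ᵀ v` of the value
at time `0` is injective on the eigenspace, which is therefore one-dimensional. -/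
theorem isSimpleFloquetMultiplier_one {K₀ : Fin n → ℝ} {ε δ : ℝ} (hε : ε ≠ 0)
    (hδ : δ ∈ Ioo 0 O.T)
    (hKinj : ∀ v : Fin n → ℂ, O.P₀.map Complex.ofReal *ᵥ v = v →
      (fun j => (K₀ j : ℂ)) ⬝ᵥ v = 0 → v = 0)
    (hgen : ∀ φ χ : O.History × O.History, O.IsTimeTImage K₀ ε δ χ χ →
        O.IsTimeTImage K₀ ε δ φ (φ + χ) → χ = 0) :
    O.IsSimpleFloquetMultiplier K₀ ε δ 1 := by
  set K : Fin n → ℂ := fun j => (K₀ j : ℂ)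
  obtain ⟨hPv₀, -, -, hz₀⟩ := (O.isTimeTImage_tangent K₀ ε δ).exists_pulse_of_fixed hδ hε
  have hv₀ : O.tangent O.final ≠ 0 := fun h => O.tangent_ne_zero (congrArg Prod.fst (hz₀ h))
  let χ₀ : O.phaseSpace ε := ⟨(O.tangent, O.tangent), by
    have h1 := (O.isTimeTImage_tangent K₀ ε δ).fst_eq O.start
    have h2 : O.tangent O.final = O.tangent O.start := by simpa [start] using h1.symm
    change O.tangent O.final = _ • O.tangent O.start + _ • O.tangent O.start
    rw [h2]
    module⟩
  have hχ0 : χ₀ ≠ 0 := fun h => O.tangent_ne_zero (congrArg (fun φ => φ.1.1) h)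
  have himg := O.isTimeTImage_timeTMap K₀ ε δ
  have hχ : O.timeTMap K₀ ε δ χ₀ = χ₀ := Subtype.ext <|
    (O.existsUnique_isTimeTImage K₀ ε δ χ₀).unique (himg χ₀) (O.isTimeTImage_tangent K₀ ε δ)
  have hχmem : χ₀ ∈ Module.End.eigenspace (O.timeTMap K₀ ε δ) 1 := by
    rw [Module.End.mem_eigenspace_iff, one_smul, hχ]
  have hmult : O.IsFloquetMultiplier K₀ ε δ 1 :=
    Module.End.hasEigenvalue_of_hasEigenvector ⟨hχmem, hχ0⟩
  refine ⟨hmult, finrank_maxGenEigenspace_one _ hχ0 hχ (fun x hx => ?_) fun x χ h1 h2 => ?_⟩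
  · have hKχ : K ⬝ᵥ O.tangent O.final ≠ 0 := fun h => hv₀ (hKinj _ hPv₀ h)
    set c := -((K ⬝ᵥ x.1.1 O.final) / (K ⬝ᵥ O.tangent O.final)) with hc
    refine ⟨c, ?_⟩
    have hfix : O.timeTMap K₀ ε δ (x + c • χ₀) = x + c • χ₀ := by
      rw [map_add, map_smul, hx, hχ]
    have hfix' : O.IsTimeTImage K₀ ε δ (x + c • χ₀ : O.phaseSpace ε)
        (x + c • χ₀ : O.phaseSpace ε) := by
      have := himg (x + c • χ₀)
      rwa [hfix] at this
    obtain ⟨hPx, -, -, hz⟩ := hfix'.exists_pulse_of_fixed hδ hε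
    have h0 := hz (hKinj _ hPx (by
      change K ⬝ᵥ (x.1.1 O.final + c • O.tangent O.final) = 0
      rw [dotProduct_add, dotProduct_smul, smul_eq_mul, hc, neg_mul, div_mul_cancel₀ _ hKχ,
        add_neg_cancel]))
    exact Subtype.ext h0
  · refine Subtype.ext (hgen x χ ?_ ?_)
    · have := himg χ
      rwa [h1] at this
    · have := himg x
      rwa [h2] at this

end ControlledOrbit

end DelayedFeedback

theorem mainTheorem2 {n : ℕ} (O : DelayedFeedback.ControlledOrbit n) (K₀ : Fin n → ℝ)
    (r : ℝ) (hr : r < 1)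
    (hspec : ∀ z ∈ spectrum ℂ
      ((O.P₀ * NormedSpace.exp (-Matrix.vecMulVec (O.b 0) K₀)).map Complex.ofReal), ‖z‖ < r) :
    ∃ εmax ∈ Set.Ioo (0 : ℝ) 1, ∃ δmax ∈ Set.Ioo (0 : ℝ) O.T,
      ∀ ε ∈ Set.Ioo 0 εmax, ∀ δ ∈ Set.Ioo 0 δmax,
        O.IsSimpleFloquetMultiplier K₀ ε δ 1 ∧
          ∀ lam : ℂ, O.IsFloquetMultiplier K₀ ε δ lam → lam ≠ 1 → ‖lam‖ < 1 := by
  have hH : ∀ (lam : ℂ) (v : Fin n → ℂ), 1 ≤ ‖lam‖ → lam • v = O.P₀.map Complex.ofReal *ᵥ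
      (v - (dslope Complex.exp 0 (-((K₀ ⬝ᵥ O.b 0 : ℝ) : ℂ)) * ((fun j => (K₀ j : ℂ)) ⬝ᵥ v)) •
        fun i => (O.b 0 i : ℂ)) → v = 0 :=
    fun lam v => DelayedFeedback.eq_zero_of_smul_eq_impulseMap hr hspec
  obtain ⟨εmax, hεmax, δmax, hδmax, h⟩ := O.exists_no_outer_multiplier_no_jordanChain hH
  refine ⟨εmax, hεmax, δmax, hδmax, fun ε hε δ hδ => ?_⟩
  obtain ⟨hout, hgen⟩ := h ε hε δ hδ
  refine ⟨O.isSimpleFloquetMultiplier_one hε.1.ne' ⟨hδ.1, hδ.2.trans hδmax.2⟩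
    (fun v hv hKv => hH 1 v (by simp) ?_) hgen, fun lam hl hl1 => ?_⟩
  · rw [hKv, mul_zero, zero_smul, sub_zero, one_smul, hv]
  · by_contra! hlam
    obtain ⟨x, hx, hx0⟩ := hl.exists_hasEigenvector
    rw [Module.End.mem_eigenspace_iff] at hx
    refine hx0 (Subtype.ext (hout lam x hlam hl1 ?_))
    have := O.isTimeTImage_timeTMap K₀ ε δ x
    rwa [hx] at this
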